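/- **Setting.** Let $\gamma_+>\gamma_->0$ be constants and put $a_0=\sqrt{\gamma_- /\gamma_+}<1$. Write $x=(x',x_3)\in\mathbb R^3$ with $x'=(x_1,x_2)$, $\mathbb R^3_-=\{x: x_3<0\}$, and $\tilde z'=(z_1,z_2,0)$ for $z'=(z_1,z_2)\in\mathbb R^2$. For $\rho\ge 0$ let $$R(\rho)=\frac{4\sqrt{\gamma_-}\sqrt{a_0^2+\rho^2}\sqrt{1+\rho^2}}{\sqrt{a_0^2+\rho^2}+a_0^2\sqrt{1+\rho^2}},$$ and for $\tau>0$, $x\in\mathbb R^3_-$, $z'\in\mathbb R^2$ define the refracted part $$E^{\gamma_-}_\tau(x,z')=\frac{\tau}{(2\pi)^3}\int_{\mathbb R^3}e^{i\tau\xi\cdot(x-\tilde z')}\,\frac{R(\sqrt{\gamma_-}\,|\xi'|)}{\gamma_-|\xi|^2+1}\,d\xi ,$$ where the (not absolutely convergent) Fourier integral is evaluated as the iterated integral, first over $\xi_3\in\mathbb R$ and then over $\xi'\in\mathbb R^2$. For $\delta>0$ let $\mathcal U_\delta(x)=\{z'\in\mathbb R^2 : |x'-z'|<a_0\delta|x-\tilde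 z'|\}$, and put $$E_0(x-\tilde z')=\frac{4\sqrt{\gamma_-}\,|x_3|\sqrt{a_0^2|x-\tilde z'|^2-|x'-z'|^2}}{|x-\tilde z'|\big(\sqrt{a_0^2|x-\tilde z'|^2-|x'-z'|^2}+a_0^2|x_3|\big)},\qquad G_{k,0}(x-\tilde z')=E_0(x-\tilde z')\,\frac{(x-\tilde z')_k}{|x-\tilde z'|}\quad(k=1,2,3).$$ **Proposition.** Fix $0<\delta<1$. Then for all $\tau>0$, $x\in\mathbb R^3_-$ and $z'\in\overline{\mathcal U_1(x)\setminus\mathcal U_\delta(x)}$ the partial derivatives $\partial_{x_k}E^{\gamma_-}_\tau(x,z')$ $(k=1,2,3)$ exist, and $$E^{\gamma_-}_\tau(x,z')=\frac{e^{-\tau|x-\tilde z'|/\sqrt{\gamma_-}}}{4\pi\gamma_-|x-\tilde z'|}\Big(E_0(x-\tilde z')+\tilde E_{0,0}(x,z';\tau)\Big),$$ $$\partial_{x_k}E^{\gamma_-}_\tau(x,z')=\frac{-\tau\,e^{-\tau|x-\tilde z'|/\sqrt{\gamma_-}}}{4\pi\gamma_-^{3/2}|x-\tilde z'|}\Big(G_{k,0}(x-\tilde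 z')+\tilde E_{k,0}(x,z';\tau)\Big)\qquad(k=1,2,3),$$ where the remainders satisfy the following: for every $s_0>0$ there is a constant $C_{\delta,s_0}>0$, independent of $x$, $z'$ and $\tau$ (it may depend on $\gamma_\pm$), such that $$|\tilde E_{k,0}(x,z';\tau)|\le C_{\delta,s_0}\Big(\frac{\sqrt{\gamma_-}}{\tau|x-\tilde z'|}\Big)^{1/4}\qquad(k=0,1,2,3)$$ for all $x\in\mathbb R^3_-$, $z'\in\overline{\mathcal U_1(x)\setminus\mathcal U_\delta(x)}$ and $\tau>0$ with $\tau|x-\tilde z'|/\sqrt{\gamma_-}\ge s_0$. -/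

import Mathlib

noncomputable section

namespace TwoLayer

/-- `ℝ³` with the Euclidean norm; the coordinates `x₁, x₂, x₃` are `x 0, x 1, x 2`. -/
abbrev E3 := EuclideanSpace ℝ (Fin 3)

/-- `ℝ²` with the Euclidean norm. -/
abbrev E2 := EuclideanSpace ℝ (Fin 2)

/-- The point `(p', s) ∈ ℝ³` for `p' ∈ ℝ²` and `s ∈ ℝ`. -/
def join (p : E2) (s : ℝ) : E3 := !₂[p 0, p 1, s]

/-- The horizontal part `x' = (x₁, x₂)` of `x = (x₁, x₂, x₃)`. -/
def horiz (x : E3) : E2 := !₂[x 0, x 1]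

/-- The point `z̃' = (z', 0)` of the transmission boundary `x₃ = 0`. -/
def lift (z : E2) : E3 := join z 0

/-- `a₀ = √(γ₋ / γ₊)`. -/
def a0 (γp γm : ℝ) : ℝ := Real.sqrt (γm / γp)

/-- The transmission coefficient `R(ρ)`, `ρ ≥ 0`. -/
def transCoeff (γp γm ρ : ℝ) : ℝ :=
  4 * Real.sqrt γm * Real.sqrt (a0 γp γm ^ 2 + ρ ^ 2) * Real.sqrt (1 + ρ ^ 2) /
    (Real.sqrt (a0 γp γm ^ 2 + ρ ^ 2) + a0 γp γm ^ 2 * Real.sqrt (1 + ρ ^ 2))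

/-- The integrand `e^{iτ ξ·(x - z̃')} (γ₋ |ξ|² + 1)⁻¹ R(√γ₋ |ξ'|)`, `ξ ∈ ℝ³`. -/
def refractedIntegrand (γp γm τ : ℝ) (x : E3) (z : E2) (ξ : E3) : ℂ :=
  Complex.exp (Complex.I * ((τ * inner ℝ ξ (x - lift z) : ℝ) : ℂ)) *
    ((1 / (γm * ‖ξ‖ ^ 2 + 1) * transCoeff γp γm (Real.sqrt γm * ‖horiz ξ‖) : ℝ) : ℂ)

/-- The refracted part `E_τ^{γ₋}(x, z')`, for `x₃ < 0`.
The integrand is only of order `|ξ'| / |ξ|²` at infinity, so its integral over `ℝ³` is not absolutely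
convergent but an oscillatory Fourier integral. It is evaluated as the iterated integral, first over
`ξ₃` and then over `ξ'`; since `x₃ ≠ 0` the `ξ₃`-integral decays exponentially in `|ξ'|`, so both
integrations converge absolutely. -/
def refractedPart (γp γm τ : ℝ) (x : E3) (z : E2) : ℂ :=
  ((τ / (2 * Real.pi) ^ 3 : ℝ) : ℂ) *
    ∫ ξ' : E2, ∫ ξ₃ : ℝ, refractedIntegrand γp γm τ x z (join ξ' ξ₃)

/-- The set `𝒰_δ(x) = {z' ∈ ℝ² : |x' - z'| < a₀ δ |x - z̃'|}`. -/
def cone (γp γm δ : ℝ) (x : E3) : Set E2 :=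
  {z | ‖horiz x - z‖ < a0 γp γm * δ * ‖x - lift z‖}

/-- The leading amplitude `E₀(X)`, as a function of `X = x - z̃'` (so `X' = x' - z'`, `X₃ = x₃`). -/
def leadE (γp γm : ℝ) (X : E3) : ℝ :=
  4 * Real.sqrt γm * |X 2| * Real.sqrt (a0 γp γm ^ 2 * ‖X‖ ^ 2 - ‖horiz X‖ ^ 2) /
    (‖X‖ * (Real.sqrt (a0 γp γm ^ 2 * ‖X‖ ^ 2 - ‖horiz X‖ ^ 2) + a0 γp γm ^ 2 * |X 2|))

/-- The leading amplitude `G_{k,0}(X) = E₀(X) X_k / |X|` of the `x_k`-derivative, `X = x - z̃'`. -/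
def leadG (γp γm : ℝ) (k : Fin 3) (X : E3) : ℝ :=
  leadE γp γm X * (X k / ‖X‖)

/-- `F` has at `x` the partial derivative `d` with respect to `x_k`. -/
def HasPartialAt (F : E3 → ℂ) (k : Fin 3) (d : ℂ) (x : E3) : Prop :=
  HasDerivAt (fun t : ℝ => F (x + t • EuclideanSpace.single k (1 : ℝ))) d 0

end TwoLayer

end

/-! Fourier inversion turns the `ξ₃`-integral into a decaying exponential. With `w = √γ₋ ξ'` and the
plane identified with `ℂ` so that `u.re` runs along `X'`, where `X = x - z̃'`, the refracted part
becomes an integral over the unit hyperboloid with invariant measure `du / height u`. Put `sin α =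
|X'|/|X|`, `cos α = |X₃|/|X|` and `λ = τ|X|/√γ₋`. The exponent is `-λ (height u * cos α - i u.re sin
α)`.

On each line `u.im = y` the substitution `u.re = √(1+y²) sinh t` makes this `-λ √(1+y²) cosh (t -
iα)`. Moving the contour to `t + iα` leaves the real exponent `-λ * height u`. The amplitude
contains `√(p² - (1 - a²))`, `a = a₀`, whose cut is avoided for `sin α ≤ a` and `y ≠ 0`; hence the
validity up to the critical angle (`integral_boostIntegrand`).

After the shift the Laplace integral is radial and explicit in `v = height u - 1`. The error is
governed by the variation of the amplitude away from `v = 0`. At the critical angle the square root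
has its branch point there, so only a Hölder-1/2 estimate is uniform. Momenta move by `O(v^(1/2))`,
the amplitude by `O(v^(1/4))`, and integration against `e^{-λv}` yields `λ^(-1/4)`
(`norm_laplace_sub_le`).

A derivative in `x_k` multiplies the integrand by an affine function of the momentum, with value
`-X_k/|X|` at the saddle. Amplitudes of the form symbol times affine function therefore cover all
four formulas. -/

namespace TwoLayer
-- Fourier integral, contour shift and radial integrals on the hyperboloid.
section Analysis
open MeasureTheory Set Filter Topology

theorem fourier_exp_neg_mul_abs {A : ℝ} (hA : 0 < A) (w : ℝ) :
    FourierTransform.fourier (fun x : ℝ => Complex.exp (-A * |x| : ℝ)) w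
      = ((2 * A / ((2 * Real.pi * w) ^ 2 + A ^ 2) : ℝ) : ℂ) := by
  rw [Real.fourier_real_eq_integral_exp_smul]
  have hp : ((A : ℂ) - 2 * Real.pi * w * Complex.I).re > 0 := by simpa using hA
  have hn : (-(A : ℂ) - 2 * Real.pi * w * Complex.I).re < 0 := by simpa using hA
  have e1 : EqOn (fun v : ℝ => Complex.exp (↑(-2 * Real.pi * v * w) * Complex.I) •
      Complex.exp (-A * |v| : ℝ))
      (fun v : ℝ => Complex.exp (((A : ℂ) - 2 * Real.pi * w * Complex.I) * v)) (Iic 0) := by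
    intro v hv
    simp only [smul_eq_mul, ← Complex.exp_add]
    rw [abs_of_nonpos hv]
    congr 1
    push_cast
    ring
  have e2 : EqOn (fun v : ℝ => Complex.exp (↑(-2 * Real.pi * v * w) * Complex.I) •
      Complex.exp (-A * |v| : ℝ))
      (fun v : ℝ => Complex.exp ((-(A : ℂ) - 2 * Real.pi * w * Complex.I) * v)) (Ioi 0) := by
    intro v hv
    simp only [smul_eq_mul, ← Complex.exp_add]
    rw [abs_of_pos hv]
    congr 1
    push_cast
    ring
  rw [← intervalIntegral.integral_Iic_add_Ioi (b := 0)
    ((integrableOn_congr_fun e1 measurableSet_Iic).2 (integrableOn_exp_mul_complex_Iic hp 0))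
    ((integrableOn_congr_fun e2 measurableSet_Ioi).2 (integrableOn_exp_mul_complex_Ioi hn 0)),
    setIntegral_congr_fun measurableSet_Iic e1, setIntegral_congr_fun measurableSet_Ioi e2,
    integral_exp_mul_complex_Iic hp, integral_exp_mul_complex_Ioi hn]
  have h1 : (A : ℂ) - 2 * Real.pi * w * Complex.I ≠ 0 := fun h => by simp [h] at hp
  have h2 : -(A : ℂ) - 2 * Real.pi * w * Complex.I ≠ 0 := fun h => by simp [h] at hn
  have hD : (2 * Real.pi * w : ℂ) ^ 2 + A ^ 2 =
      -((A - 2 * Real.pi * w * Complex.I) * (-(A : ℂ) - 2 * Real.pi * w * Complex.I)) := by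
    linear_combination (4 * Real.pi ^ 2 * w ^ 2 : ℂ) * Complex.I_sq
  push_cast
  simp only [mul_zero, Complex.exp_zero]
  rw [hD, div_add_div _ _ h1 h2, div_neg, ← neg_div]
  congr 1
  ring

/-- Fourier inversion for `e^{-A|x|}`, whose transform is an integrable Lorentzian. -/
theorem integral_cexp_mul_I_div_sq_add_sq {A : ℝ} (hA : 0 < A) (k : ℝ) :
    ∫ s : ℝ, Complex.exp (Complex.I * ((k * s : ℝ) : ℂ)) * ((1 / (s ^ 2 + A ^ 2) : ℝ) : ℂ)
      = ((Real.pi / A * Real.exp (-A * |k|) : ℝ) : ℂ) := by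
  set f : ℝ → ℂ := fun x : ℝ => Complex.exp (-A * |x| : ℝ) with hf
  have hfc : Continuous f := by fun_prop
  have hfi : Integrable f := by
    have h : Integrable (fun x : ℝ => Real.exp (-A * |x|)) := by
      rw [← integrableOn_univ, ← Iic_union_Ioi (a := (0 : ℝ))]
      refine IntegrableOn.union ?_ ?_
      · refine (integrableOn_exp_mul_Iic hA 0).congr_fun (fun x hx => ?_) measurableSet_Iic
        simp [abs_of_nonpos (show x ≤ 0 from hx)]
      · refine (integrableOn_exp_mul_Ioi (neg_lt_zero.2 hA) 0).congr_fun (fun x hx => ?_)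
          measurableSet_Ioi
        simp [abs_of_pos (show 0 < x from hx)]
    simpa [hf] using h.ofReal (𝕜 := ℂ)
  have hF : FourierTransform.fourier f
      = fun w : ℝ => ((2 * A / ((2 * Real.pi * w) ^ 2 + A ^ 2) : ℝ) : ℂ) :=
    funext (fourier_exp_neg_mul_abs hA)
  have hFi : Integrable (FourierTransform.fourier f) := by
    rw [hF]
    refine Integrable.ofReal ?_
    have := (integrable_inv_one_add_sq.comp_mul_left' (R := 2 * Real.pi / A)
      (by positivity)).const_mul (2 / A)
    refine this.congr (Eventually.of_forall fun w => ?_)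
    have : 0 < (2 * Real.pi * w) ^ 2 + A ^ 2 := by positivity
    have h : 1 + (2 * Real.pi / A * w) ^ 2 = ((2 * Real.pi * w) ^ 2 + A ^ 2) / A ^ 2 := by
      field_simp
      ring
    simp only [h, inv_div]
    change _ = 2 * A / ((2 * Real.pi * w) ^ 2 + A ^ 2)
    rw [div_mul_div_comm, div_eq_div_iff (by positivity) (by positivity)]
    ring
  have key := congrFun (hfc.fourierInv_fourier_eq hfi hFi) k
  rw [Real.fourierInv_eq', hF] at key
  have h2 := Measure.integral_comp_mul_left (fun s : ℝ =>
    Complex.exp (Complex.I * ((k * s : ℝ) : ℂ)) * ((1 / (s ^ 2 + A ^ 2) : ℝ) : ℂ)) (2 * Real.pi)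
  have h3 : ∀ v : ℝ, Complex.exp (↑(2 * Real.pi * inner ℝ v k) * Complex.I) •
      ((2 * A / ((2 * Real.pi * v) ^ 2 + A ^ 2) : ℝ) : ℂ) = (2 * A : ℂ) *
      (Complex.exp (Complex.I * ((k * (2 * Real.pi * v) : ℝ) : ℂ)) *
        ((1 / ((2 * Real.pi * v) ^ 2 + A ^ 2) : ℝ) : ℂ)) := by
    intro v
    simp only [smul_eq_mul, RCLike.inner_apply]
    have : Complex.I * ((k * (2 * Real.pi * v) : ℝ) : ℂ)
      = ↑(2 * Real.pi * RCLike.re ((starRingEnd ℝ) v * k)) * Complex.I := by simp; ring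
    simp
    ring_nf
  simp only [h3] at key
  rw [integral_const_mul, h2, abs_of_pos (by positivity)] at key
  have hA' : (A : ℂ) ≠ 0 := by exact_mod_cast hA.ne'
  have hpi : (Real.pi : ℂ) ≠ 0 := by exact_mod_cast Real.pi_ne_zero
  simp only [Complex.real_smul] at key
  push_cast at key ⊢
  simp only [hf] at key
  push_cast at key
  field_simp at key ⊢
  linear_combination key

/-- Shift of the line of integration across the strip `0 ≤ Im z ≤ β`. -/
theorem integral_shift_of_decay {f : ℂ → ℂ} {β : ℝ} (hβ : 0 ≤ β)
    (hc : ∀ t y : ℝ, y ∈ Icc 0 β → DifferentiableAt ℂ f (t + y * Complex.I))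
    {g : ℝ → ℝ} (hg : ∀ t y : ℝ, y ∈ Icc 0 β → ‖f (t + y * Complex.I)‖ ≤ g |t|)
    (hg0 : Tendsto g atTop (𝓝 0))
    (h0 : Integrable (fun t : ℝ => f t)) (h1 : Integrable (fun t : ℝ => f (t + β * Complex.I))) :
    ∫ t : ℝ, f t = ∫ t : ℝ, f (t + β * Complex.I) := by
  -- The sign `σ = ±1` treats both vertical sides of the rectangle at once; they vanish by the decay
  -- of `g`.
  have hside : ∀ σ : ℝ, |σ| = 1 →
      Tendsto (fun T : ℝ => ∫ y in (0 : ℝ)..β, f ((σ * T : ℝ) + y * Complex.I)) atTop (𝓝 0) := by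
    intro σ hσ
    refine squeeze_zero_norm' (a := fun T => g T * |β - 0|) ?_ (by simpa using hg0.mul_const |β - 0|)
    filter_upwards [eventually_ge_atTop 0] with T hT
    refine intervalIntegral.norm_integral_le_of_norm_le_const fun y hy => ?_
    rw [uIoc_of_le hβ] at hy
    have := hg (σ * T) y ⟨hy.1.le, hy.2⟩
    rwa [abs_mul, hσ, one_mul, abs_of_nonneg hT] at this
  have hrect : ∀ T : ℝ, (∫ t in (-T)..T, f t) - (∫ t in (-T)..T, f (t + β * Complex.I))
      + Complex.I * (∫ y in (0 : ℝ)..β, f ((1 * T : ℝ) + y * Complex.I))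
      - Complex.I * (∫ y in (0 : ℝ)..β, f (((-1) * T : ℝ) + y * Complex.I)) = 0 := by
    intro T
    have := Complex.integral_boundary_rect_eq_zero_of_differentiableOn f (-T : ℝ)
      ((T : ℝ) + β * Complex.I) (by
        intro z hz
        rw [Complex.mem_reProdIm] at hz
        have hz2 := hz.2
        simp only [Complex.ofReal_im, Complex.add_im, Complex.mul_im, Complex.ofReal_re,
          Complex.I_im, mul_one, Complex.I_re, mul_zero, add_zero, zero_add, uIcc_of_le hβ] at hz2
        have := hc z.re z.im hz2
        rw [Complex.re_add_im] at this
        exact this.differentiableWithinAt)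
    simpa using this
  have hI := intervalIntegral_tendsto_integral h0 tendsto_neg_atTop_atBot tendsto_id
  have hII := intervalIntegral_tendsto_integral h1 tendsto_neg_atTop_atBot tendsto_id
  have hlim := ((hI.sub hII).add ((hside 1 (by simp)).const_mul Complex.I)).sub
    ((hside (-1) (by simp)).const_mul Complex.I)
  have := tendsto_nhds_unique (tendsto_const_nhds.congr fun T => (hrect T).symm) hlim
  simp only [mul_zero, add_zero, sub_zero] at this
  exact (sub_eq_zero.1 this.symm)

theorem range_mul_sinh {m : ℝ} (hm : 0 < m) : (fun t => m * Real.sinh t) '' univ = univ := by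
  rw [image_univ, range_eq_univ]
  intro y
  obtain ⟨t, ht⟩ := Real.sinh_surjective (y / m)
  exact ⟨t, by simp only [ht]; field_simp⟩

theorem injOn_mul_sinh {m : ℝ} (hm : 0 < m) : InjOn (fun t => m * Real.sinh t) univ :=
  fun _ _ _ _ h => Real.sinh_injective (mul_left_cancel₀ hm.ne' h)

theorem sqrt_sq_add_mul_sinh_sq {m : ℝ} (hm : 0 < m) (t : ℝ) :
    √(m ^ 2 + (m * Real.sinh t) ^ 2) = m * Real.cosh t := by
  rw [show m ^ 2 + (m * Real.sinh t) ^ 2 = (m * Real.cosh t) ^ 2 by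
    rw [mul_pow, mul_pow, Real.cosh_sq]; ring]
  exact Real.sqrt_sq (mul_pos hm (Real.cosh_pos t)).le

theorem hasDerivWithinAt_mul_sinh (m : ℝ) : ∀ t ∈ (univ : Set ℝ),
    HasDerivWithinAt (fun t => m * Real.sinh t) (m * Real.cosh t) univ t :=
  fun t _ => ((Real.hasDerivAt_sinh t).const_mul m).hasDerivWithinAt

/-- `du / √(m² + u²)` is `dt` in rapidity, so a hyperbolic rotation of the momentum becomes a
translation of `t`. -/
theorem integral_comp_mul_sinh {m : ℝ} (hm : 0 < m) (h : ℝ → ℂ) :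
    ∫ u : ℝ, (√(m ^ 2 + u ^ 2))⁻¹ • h u = ∫ t : ℝ, h (m * Real.sinh t) := by
  have := integral_image_eq_integral_abs_deriv_smul MeasurableSet.univ
    (hasDerivWithinAt_mul_sinh m) (injOn_mul_sinh hm) (fun u => (√(m ^ 2 + u ^ 2))⁻¹ • h u)
  rw [range_mul_sinh hm, setIntegral_univ, setIntegral_univ] at this
  rw [this]
  refine integral_congr_ae (Eventually.of_forall fun t => ?_)
  have hp : 0 < m * Real.cosh t := mul_pos hm (Real.cosh_pos t)
  simp only [sqrt_sq_add_mul_sinh_sq hm, smul_smul]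
  rw [abs_of_pos hp, mul_inv_cancel₀ hp.ne', one_smul]

theorem integrable_comp_mul_sinh {m : ℝ} (hm : 0 < m) (h : ℝ → ℂ) :
    Integrable (fun u : ℝ => (√(m ^ 2 + u ^ 2))⁻¹ • h u) ↔
      Integrable (fun t : ℝ => h (m * Real.sinh t)) := by
  have := integrableOn_image_iff_integrableOn_abs_deriv_smul MeasurableSet.univ
    (hasDerivWithinAt_mul_sinh m) (injOn_mul_sinh hm) (fun u => (√(m ^ 2 + u ^ 2))⁻¹ • h u)
  rw [range_mul_sinh hm, integrableOn_univ, integrableOn_univ] at this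
  rw [this]
  refine integrable_congr (Eventually.of_forall fun t => ?_)
  have hp : 0 < m * Real.cosh t := mul_pos hm (Real.cosh_pos t)
  simp only [sqrt_sq_add_mul_sinh_sq hm, smul_smul]
  rw [abs_of_pos hp, mul_inv_cancel₀ hp.ne', one_smul]

/-- The height `√(1 + |u|²)` of the point of the unit hyperboloid above `u`. -/
noncomputable def height (u : ℂ) : ℝ := √(1 + ‖u‖ ^ 2)

theorem image_sqrt_one_add_sq_sub_one : (fun y : ℝ => √(1 + y ^ 2) - 1) '' Ioi 0 = Ioi 0 := by
  ext v
  constructor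
  · rintro ⟨y, hy, rfl⟩
    have hy : 0 < y := hy
    have : 1 < √(1 + y ^ 2) := Real.lt_sqrt_of_sq_lt (by nlinarith)
    simpa using this
  · intro hv
    have hv : 0 < v := hv
    refine ⟨√((1 + v) ^ 2 - 1), Real.sqrt_pos.2 (by nlinarith), ?_⟩
    simp only
    rw [Real.sq_sqrt (by nlinarith), add_sub_cancel, Real.sqrt_sq (by positivity)]
    ring

theorem injOn_sqrt_one_add_sq_sub_one : InjOn (fun y : ℝ => √(1 + y ^ 2) - 1) (Ioi 0) := by
  intro x hx y hy h
  have h1 : √(1 + x ^ 2) = √(1 + y ^ 2) := by simpa using h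
  rw [Real.sqrt_inj (by positivity) (by positivity)] at h1
  exact (sq_eq_sq₀ (le_of_lt hx) (le_of_lt hy)).1 (by linarith)

theorem hasDerivWithinAt_sqrt_one_add_sq_sub_one : ∀ y ∈ Ioi (0 : ℝ),
    HasDerivWithinAt (fun y : ℝ => √(1 + y ^ 2) - 1) (y / √(1 + y ^ 2)) (Ioi 0) y := by
  intro y _
  have h := ((((hasDerivAt_id y).pow 2).const_add 1).sqrt
    (show (1 : ℝ) + id y ^ 2 ≠ 0 by simp only [id]; positivity)).sub_const 1
  refine (h.congr_deriv ?_).hasDerivWithinAt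
  simp
  field_simp

/-- In polar coordinates `v = √(1 + r²) - 1` has `dv = r dr / √(1 + r²)`, so the invariant measure
is exactly `2π dv` on radial functions. The Laplace integrals below are thus evaluated without
error. -/
theorem integral_radial_height (f : ℝ → ℝ) :
    ∫ u : ℂ, f (height u - 1) / height u = 2 * Real.pi * ∫ v in Ioi (0 : ℝ), f v := by
  have h := integral_fun_norm_addHaar (volume : Measure ℂ)
    (fun y : ℝ => f (√(1 + y ^ 2) - 1) / √(1 + y ^ 2))
  have hb : (volume : Measure ℂ).real (Metric.ball 0 1) = Real.pi := by
    simp [Measure.real, Complex.volume_ball]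
  have h2 := integral_image_eq_integral_abs_deriv_smul measurableSet_Ioi
    hasDerivWithinAt_sqrt_one_add_sq_sub_one injOn_sqrt_one_add_sq_sub_one f
  rw [image_sqrt_one_add_sq_sub_one] at h2
  simp only [height]
  rw [h, hb, Complex.finrank_real_complex, h2]
  simp only [smul_eq_mul, nsmul_eq_mul]
  push_cast
  rw [mul_assoc]
  congr 2
  refine setIntegral_congr_fun measurableSet_Ioi fun y hy => ?_
  have hy : 0 < y := hy
  rw [abs_of_pos (by positivity)]
  simp
  ring

theorem integrable_radial_height {f : ℝ → ℝ} (hf : IntegrableOn f (Ioi 0)) :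
    Integrable (fun u : ℂ => f (height u - 1) / height u) := by
  have h := integrable_fun_norm_addHaar (volume : Measure ℂ)
    (f := fun y : ℝ => f (√(1 + y ^ 2) - 1) / √(1 + y ^ 2))
  have h2 := integrableOn_image_iff_integrableOn_abs_deriv_smul measurableSet_Ioi
    hasDerivWithinAt_sqrt_one_add_sq_sub_one injOn_sqrt_one_add_sq_sub_one f
  rw [image_sqrt_one_add_sq_sub_one] at h2
  refine h.2 ((h2.1 hf).congr_fun (fun y hy => ?_) measurableSet_Ioi)
  have hy : 0 < y := hy
  simp only [Complex.finrank_real_complex]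
  rw [abs_of_pos (by positivity)]
  simp
  ring

theorem integrableOn_exp_mul_rpow {lam s : ℝ} (hl : 0 < lam) (hs : 0 ≤ s) :
    IntegrableOn (fun v : ℝ => Real.exp (-(lam * v)) * v ^ s) (Ioi 0) := by
  have := integrableOn_rpow_mul_exp_neg_mul_rpow (s := s) (p := 1) (b := lam) (by linarith)
    one_pos hl
  refine this.congr_fun (fun v _ => ?_) measurableSet_Ioi
  simp [mul_comm]

theorem integrable_exp_height {lam s : ℝ} (hl : 0 < lam) (hs : 0 ≤ s) :
    Integrable (fun u : ℂ => Real.exp (-(lam * (height u - 1))) * (height u - 1) ^ s / height u) :=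
  integrable_radial_height (integrableOn_exp_mul_rpow hl hs)

theorem integral_exp_height {lam s : ℝ} (hl : 0 < lam) (hs : 0 ≤ s) :
    ∫ u : ℂ, Real.exp (-(lam * (height u - 1))) * (height u - 1) ^ s / height u
      = 2 * Real.pi * ((1 / lam) ^ (s + 1) * Real.Gamma (s + 1)) := by
  rw [integral_radial_height (fun v => Real.exp (-(lam * v)) * v ^ s),
    ← Real.integral_rpow_mul_exp_neg_mul_Ioi (by linarith : 0 < s + 1) hl]
  simp [mul_comm]

end Analysis
-- Bounds, Hölder continuity and analyticity of the continued transmission coefficient.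
section Symbol
open MeasureTheory Set Filter Topology

theorem sq_csqrt (z : ℂ) : Complex.sqrt z ^ 2 = z := by
  simp [Complex.sqrt]

theorem re_csqrt_nonneg (z : ℂ) : 0 ≤ (Complex.sqrt z).re := by
  rw [Complex.sqrt, Complex.cpow_inv_two_re]
  exact Real.sqrt_nonneg _

theorem norm_csqrt_sq (z : ℂ) : ‖Complex.sqrt z‖ ^ 2 = ‖z‖ := by
  rw [← norm_pow, sq_csqrt]

/-- Two points of the closed right half-plane, one of them real, are no farther apart than the
length of their sum. This is the Hölder-1/2 estimate for the square root; it survives at the branch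
point `r = 0`. -/
theorem norm_sub_sq_le_of_re_nonneg {p : ℂ} {r : ℝ} (hp : 0 ≤ p.re) (hr : 0 ≤ r) :
    ‖p - r‖ ^ 2 ≤ ‖p ^ 2 - (r : ℂ) ^ 2‖ := by
  have h : ‖p - r‖ ≤ ‖p + r‖ := by
    refine (sq_le_sq₀ (norm_nonneg _) (norm_nonneg _)).1 ?_
    rw [Complex.sq_norm, Complex.sq_norm, Complex.normSq_apply, Complex.normSq_apply]
    simp
    nlinarith [mul_nonneg hp hr]
  rw [show p ^ 2 - (r : ℂ) ^ 2 = (p - r) * (p + r) by ring, norm_mul, sq]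
  exact mul_le_mul_of_nonneg_left h (norm_nonneg _)

/-- The vertical frequency `√(p² - (1 - a²))` in the upper layer, in terms of `p = √(1 + |w|²)`. -/
noncomputable def upperFreq (a : ℝ) (p : ℂ) : ℂ := Complex.sqrt (p ^ 2 - (1 - (a : ℂ) ^ 2))

/-- The analytic continuation of the normalized transmission coefficient, as a function of
`p = √(1 + |w|²)`. -/
noncomputable def symb (a : ℝ) (p : ℂ) : ℂ := upperFreq a p * p / (upperFreq a p + a ^ 2 * p)

theorem measurable_symb (a : ℝ) : Measurable (symb a) := by
  have : Measurable (upperFreq a) := by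
    unfold upperFreq Complex.sqrt
    exact Measurable.pow_const (by fun_prop) _
  unfold symb
  exact (this.mul measurable_id).div (this.add (measurable_id.const_mul _))

/-- The principal root has nonnegative real part, so the two terms of the denominator cannot cancel.
-/
theorem le_norm_upperFreq_add (a : ℝ) (p : ℂ) :
    a ^ 2 * p.re ≤ ‖upperFreq a p + a ^ 2 * p‖ := by
  refine le_trans ?_ (Complex.re_le_norm _)
  have := re_csqrt_nonneg (p ^ 2 - (1 - (a : ℂ) ^ 2))
  have e : ((a : ℂ) ^ 2 * p).re = a ^ 2 * p.re := by
    rw [← Complex.ofReal_pow, Complex.re_ofReal_mul]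
  rw [Complex.add_re, e]
  unfold upperFreq
  linarith

theorem norm_upperFreq_le {a H : ℝ} (ha : 0 < a) (ha1 : a < 1) (hH : 1 ≤ H) {p : ℂ}
    (hp : ‖p‖ ≤ H) : ‖upperFreq a p‖ ≤ 2 * H := by
  refine (sq_le_sq₀ (norm_nonneg _) (by linarith)).1 ?_
  unfold upperFreq
  rw [norm_csqrt_sq]
  have h1 : ‖(1 : ℂ) - (a : ℂ) ^ 2‖ ≤ 1 := by
    rw [← Complex.ofReal_one, ← Complex.ofReal_pow, ← Complex.ofReal_sub, Complex.norm_real,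
      Real.norm_eq_abs, abs_of_nonneg (by nlinarith)]
    nlinarith
  have h2 := norm_sub_le (p ^ 2) (1 - (a : ℂ) ^ 2)
  rw [norm_pow] at h2
  nlinarith [norm_nonneg p]

theorem norm_symb_le {a b H : ℝ} (ha : 0 < a) (ha1 : a < 1) (hb : 0 < b) (hH : 1 ≤ H) {p : ℂ}
    (hp : ‖p‖ ≤ H) (hre : b * H ≤ p.re) : ‖symb a p‖ ≤ 2 / (a ^ 2 * b) * H := by
  have hD := le_norm_upperFreq_add a p
  have hD' : a ^ 2 * b * H ≤ ‖upperFreq a p + a ^ 2 * p‖ := by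
    refine le_trans ?_ hD
    rw [mul_assoc]
    gcongr
  have h0 : 0 < a ^ 2 * b * H := by positivity
  rw [symb, norm_div, norm_mul]
  have h1 := norm_upperFreq_le ha ha1 hH hp
  calc ‖upperFreq a p‖ * ‖p‖ / ‖upperFreq a p + a ^ 2 * p‖ ≤ (2 * H) * H / (a ^ 2 * b * H) := by
        gcongr
    _ = 2 / (a ^ 2 * b) * H := by field_simp

theorem upperFreq_ofReal {a c : ℝ} (h : 1 - a ^ 2 ≤ c ^ 2) :
    upperFreq a c = (√(c ^ 2 - (1 - a ^ 2)) : ℝ) := by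
  unfold upperFreq
  rw [show (c : ℂ) ^ 2 - (1 - (a : ℂ) ^ 2) = ((c ^ 2 - (1 - a ^ 2) : ℝ) : ℂ) by push_cast; ring]
  rw [Complex.sqrt_of_nonneg (by exact_mod_cast sub_nonneg.2 h), Complex.ofReal_re]

theorem norm_upperFreq_sub_sq_le {a c : ℝ} (h : 1 - a ^ 2 ≤ c ^ 2) (p : ℂ) :
    ‖upperFreq a p - upperFreq a c‖ ^ 2 ≤ ‖p - c‖ * ‖p + c‖ := by
  rw [upperFreq_ofReal h]
  have := norm_sub_sq_le_of_re_nonneg (re_csqrt_nonneg (p ^ 2 - (1 - (a : ℂ) ^ 2)))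
    (Real.sqrt_nonneg (c ^ 2 - (1 - a ^ 2)))
  refine this.trans_eq ?_
  have e : ((√(c ^ 2 - (1 - a ^ 2)) : ℝ) : ℂ) ^ 2 = ((c ^ 2 - (1 - a ^ 2) : ℝ) : ℂ) := by
    rw [← Complex.ofReal_pow, Real.sq_sqrt (sub_nonneg.2 h)]
  rw [sq_csqrt, e, ← norm_mul]
  congr 1
  push_cast
  ring

/-- A displacement of order `e²` costs only `e`, by the Hölder estimate for `upperFreq`. No positive
lower bound on `c² - (1 - a²)` enters, so the constant does not degenerate at the critical angle. -/
theorem norm_symb_sub_le {a b c H e : ℝ} (ha : 0 < a) (ha1 : a < 1) (hb : 0 < b)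
    (hbc : b ≤ c) (hc1 : c ≤ 1) (h : 1 - a ^ 2 ≤ c ^ 2) (hH : 1 ≤ H) (he : 0 ≤ e)
    {p : ℂ} (hp : ‖p‖ ≤ H) (hre : b * H ≤ p.re) (hd : ‖p - c‖ ≤ 3 * e ^ 2) :
    ‖symb a p - symb a c‖ ≤ 15 / (a ^ 4 * b ^ 2) * (H * e) := by
  have hc0 : 0 < c := hb.trans_le hbc
  have hcn : ‖(c : ℂ)‖ ≤ 1 := by simpa [abs_of_pos hc0] using hc1
  have hd2 : ‖p - c‖ ≤ 2 * H := by
    refine (norm_sub_le _ _).trans ?_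
    linarith
  have hs2 : ‖p + c‖ ≤ 2 * H := by
    refine (norm_add_le _ _).trans ?_
    linarith
  have hdH : ‖p - c‖ ≤ 3 * (H * e) := by
    -- Geometric mean of the bounds `3e²` and `2H`, which gives the first-order factor `e` needed to
    -- match the square root.
    refine (sq_le_sq₀ (norm_nonneg _) (by positivity)).1 ?_
    calc ‖p - c‖ ^ 2 = ‖p - c‖ * ‖p - c‖ := sq _
      _ ≤ (2 * H) * (3 * e ^ 2) := by gcongr
      _ ≤ (3 * (H * e)) ^ 2 := by
        have : 0 ≤ H * e ^ 2 := by positivity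
        nlinarith
  have hQd : ‖upperFreq a p - upperFreq a c‖ ≤ 3 * (H * e) := by
    refine (sq_le_sq₀ (norm_nonneg _) (by positivity)).1 ?_
    calc ‖upperFreq a p - upperFreq a c‖ ^ 2 ≤ ‖p - c‖ * ‖p + c‖ := norm_upperFreq_sub_sq_le h p
      _ ≤ (3 * e ^ 2) * (2 * H) := by gcongr
      _ ≤ (3 * (H * e)) ^ 2 := by
        have : 0 ≤ H * e ^ 2 := by positivity
        nlinarith
  have hQ := norm_upperFreq_le ha ha1 hH hp
  have hQ0 := norm_upperFreq_le ha ha1 le_rfl hcn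
  have hD : a ^ 2 * (b * H) ≤ ‖upperFreq a p + a ^ 2 * p‖ :=
    le_trans (by gcongr) (le_norm_upperFreq_add a p)
  have hD0 : a ^ 2 * b ≤ ‖upperFreq a c + a ^ 2 * c‖ :=
    le_trans (by rw [Complex.ofReal_re]; gcongr) (le_norm_upperFreq_add a c)
  have hpos : 0 < a ^ 2 * (b * H) := by positivity
  have hpos0 : 0 < a ^ 2 * b := by positivity
  have hne : upperFreq a p + a ^ 2 * p ≠ 0 := norm_pos_iff.1 (hpos.trans_le hD)
  have hne0 : upperFreq a c + (a : ℂ) ^ 2 * (c : ℂ) ≠ 0 := norm_pos_iff.1 (hpos0.trans_le hD0)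
  have hid : symb a p - symb a c = (upperFreq a p * upperFreq a c * (p - c)
      + a ^ 2 * (p * (c * (upperFreq a p - upperFreq a c)))) /
      ((upperFreq a p + a ^ 2 * p) * (upperFreq a c + a ^ 2 * c)) := by
    unfold symb
    rw [div_sub_div _ _ hne hne0]
    congr 1
    ring
  have han : ‖(a : ℂ) ^ 2‖ ≤ 1 := by
    rw [norm_pow, Complex.norm_real, Real.norm_eq_abs, abs_of_pos ha]
    nlinarith
  have hnum : ‖upperFreq a p * upperFreq a c * (p - c)
      + a ^ 2 * (p * (c * (upperFreq a p - upperFreq a c)))‖ ≤ 15 * H * (H * e) := by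
    refine (norm_add_le _ _).trans ?_
    simp only [norm_mul]
    calc _ ≤ (2 * H) * (2 * 1) * (3 * (H * e)) + 1 * (H * (1 * (3 * (H * e)))) := by gcongr
      _ = 15 * H * (H * e) := by ring
  rw [hid, norm_div, norm_mul]
  calc _ ≤ 15 * H * (H * e) / ((a ^ 2 * (b * H)) * (a ^ 2 * b)) := by gcongr
    _ = 15 / (a ^ 4 * b ^ 2) * (H * e) := by field_simp

/-- The imaginary part is `2Hcxs`. If it vanishes then `xs = 0`, and the real part `H²c² - (1 - a²)`
exceeds `a² - s² ≥ 0`. At `s = a` the strict inequality `1 < H` is what keeps the point off the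
branch point. -/
theorem sq_sub_mem_slitPlane {a H x c s : ℝ} (hH : 1 < H) (hc : 0 < c)
    (hcs : c ^ 2 + s ^ 2 = 1) (hs : 0 ≤ s) (hsa : s ≤ a) :
    ((H * c : ℂ) + Complex.I * (x * s)) ^ 2 - (1 - (a : ℂ) ^ 2) ∈ Complex.slitPlane := by
  have e : ((H * c : ℂ) + Complex.I * (x * s)) ^ 2 - (1 - (a : ℂ) ^ 2)
      = ((H ^ 2 * c ^ 2 - x ^ 2 * s ^ 2 - (1 - a ^ 2) : ℝ) : ℂ)
        + ((2 * H * c * (x * s) : ℝ) : ℂ) * Complex.I := by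
    push_cast
    linear_combination ((x : ℂ) ^ 2 * s ^ 2) * Complex.I_sq
  rw [e, Complex.mem_slitPlane_iff]
  simp only [Complex.add_re, Complex.ofReal_re, Complex.mul_re, Complex.I_re, mul_zero,
    Complex.ofReal_im, Complex.I_im, mul_one, sub_self, add_zero, Complex.add_im, Complex.mul_im,
    zero_add]
  by_cases h : x * s = 0
  · left
    have h2 : x ^ 2 * s ^ 2 = 0 := by rw [← mul_pow, h]; ring
    have h3 : s ^ 2 ≤ a ^ 2 := by gcongr
    have h4 : c ^ 2 < H ^ 2 * c ^ 2 := by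
      have : 0 < c ^ 2 := by positivity
      exact lt_mul_of_one_lt_left this (one_lt_pow₀ hH two_ne_zero)
    linarith
  · right
    have : H * c ≠ 0 := by positivity
    positivity

theorem differentiableAt_symb {a : ℝ} {p : ℂ} (ha : 0 < a) (hp : 0 < p.re)
    (h : p ^ 2 - (1 - (a : ℂ) ^ 2) ∈ Complex.slitPlane) : DifferentiableAt ℂ (symb a) p := by
  have hQ : DifferentiableAt ℂ (upperFreq a) p := by
    unfold upperFreq Complex.sqrt
    exact DifferentiableAt.cpow (by fun_prop) (by fun_prop) h
  have hne : upperFreq a p + a ^ 2 * p ≠ 0 :=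
    norm_pos_iff.1 (lt_of_lt_of_le (by positivity) (le_norm_upperFreq_add a p))
  unfold symb
  exact (hQ.mul differentiableAt_id).div (hQ.add (differentiableAt_id.const_mul _)) hne

theorem symb_ofReal (a ρ : ℝ) :
    symb a (√(1 + ρ ^ 2) : ℝ) = ((√(a ^ 2 + ρ ^ 2) * √(1 + ρ ^ 2) /
      (√(a ^ 2 + ρ ^ 2) + a ^ 2 * √(1 + ρ ^ 2)) : ℝ) : ℂ) := by
  have h : √(1 + ρ ^ 2) ^ 2 = 1 + ρ ^ 2 := Real.sq_sqrt (by positivity)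
  unfold symb
  rw [upperFreq_ofReal (by rw [h]; nlinarith [sq_nonneg ρ, sq_nonneg a]), h]
  rw [show 1 + ρ ^ 2 - (1 - a ^ 2) = a ^ 2 + ρ ^ 2 by ring]
  push_cast
  rfl

theorem one_le_height (u : ℂ) : 1 ≤ height u :=
  Real.one_le_sqrt.2 (by nlinarith [sq_nonneg ‖u‖])

theorem height_sq (u : ℂ) : height u ^ 2 = 1 + u.re ^ 2 + u.im ^ 2 := by
  rw [height, Real.sq_sqrt (by positivity), Complex.sq_norm, Complex.normSq_apply]
  ring

theorem continuous_height : Continuous height := by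
  unfold height
  fun_prop

/-- The amplitude: the symbol times an affine function of the momentum `(w₁, w₂, w₀)`. -/
noncomputable def amp (a : ℝ) (q : Fin 4 → ℂ) (w₁ w₂ w₀ : ℂ) : ℂ :=
  symb a w₀ * (q 0 + q 1 * w₁ + q 2 * w₂ + q 3 * w₀)

theorem norm_affine_le {H : ℝ} (hH : 1 ≤ H) {q : Fin 4 → ℂ} (hq : ∀ i, ‖q i‖ ≤ 1)
    {w₁ w₂ w₀ : ℂ} (h1 : ‖w₁‖ ≤ H) (h2 : ‖w₂‖ ≤ H) (h0 : ‖w₀‖ ≤ H) :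
    ‖q 0 + q 1 * w₁ + q 2 * w₂ + q 3 * w₀‖ ≤ 4 * H := by
  have e1 : ‖q 1 * w₁‖ ≤ 1 * H := by rw [norm_mul]; gcongr; exact hq 1
  have e2 : ‖q 2 * w₂‖ ≤ 1 * H := by rw [norm_mul]; gcongr; exact hq 2
  have e3 : ‖q 3 * w₀‖ ≤ 1 * H := by rw [norm_mul]; gcongr; exact hq 3
  have := norm_add_le (q 0 + q 1 * w₁ + q 2 * w₂) (q 3 * w₀)
  have := norm_add_le (q 0 + q 1 * w₁) (q 2 * w₂)
  have := norm_add_le (q 0) (q 1 * w₁)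
  linarith [hq 0]

theorem norm_amp_le {a b H : ℝ} (ha : 0 < a) (ha1 : a < 1) (hb : 0 < b) (hH : 1 ≤ H)
    {q : Fin 4 → ℂ} (hq : ∀ i, ‖q i‖ ≤ 1)
    {w₁ w₂ w₀ : ℂ} (h1 : ‖w₁‖ ≤ H) (h2 : ‖w₂‖ ≤ H) (h0 : ‖w₀‖ ≤ H) (hre : b * H ≤ w₀.re) :
    ‖amp a q w₁ w₂ w₀‖ ≤ 8 / (a ^ 2 * b) * H ^ 2 := by
  rw [amp, norm_mul]
  calc _ ≤ (2 / (a ^ 2 * b) * H) * (4 * H) := by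
        gcongr
        · exact norm_symb_le ha ha1 hb hH h0 hre
        · exact norm_affine_le hH hq h1 h2 h0
    _ = _ := by ring

theorem norm_amp_sub_le {a b c H e : ℝ} (ha : 0 < a) (ha1 : a < 1) (hb : 0 < b)
    (hbc : b ≤ c) (hc1 : c ≤ 1) (h : 1 - a ^ 2 ≤ c ^ 2) (hH : 1 ≤ H) (he : 0 ≤ e) (heH : e ≤ H)
    {q : Fin 4 → ℂ} (hq : ∀ i, ‖q i‖ ≤ 1) {w₁ w₂ w₀ z₁ : ℂ}
    (h1 : ‖w₁‖ ≤ H) (h2 : ‖w₂‖ ≤ H) (h0 : ‖w₀‖ ≤ H) (hre : b * H ≤ w₀.re)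
    (hd1 : ‖w₁ - z₁‖ ≤ 3 * e ^ 2) (hd2 : ‖w₂‖ ≤ 3 * e ^ 2) (hd0 : ‖w₀ - c‖ ≤ 3 * e ^ 2) :
    ‖amp a q w₁ w₂ w₀ - amp a q z₁ 0 c‖ ≤
      (60 / (a ^ 4 * b ^ 2) + 18 / (a ^ 2 * b)) * (H ^ 2 * e) := by
  have hc0 : 0 < c := hb.trans_le hbc
  have hcn : ‖(c : ℂ)‖ ≤ 1 := by simpa [abs_of_pos hc0] using hc1
  have hS := norm_symb_sub_le ha ha1 hb hbc hc1 h hH he h0 hre hd0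
  have hS0 := norm_symb_le ha ha1 hb le_rfl hcn (by simpa using hbc)
  have hA := norm_affine_le hH hq h1 h2 h0
  have hAd : ‖q 1 * (w₁ - z₁) + q 2 * w₂ + q 3 * (w₀ - c)‖ ≤ 9 * (H ^ 2 * e) := by
    have e1 : ‖q 1 * (w₁ - z₁)‖ ≤ 1 * (3 * e ^ 2) := by rw [norm_mul]; gcongr; exact hq 1
    have e2 : ‖q 2 * w₂‖ ≤ 1 * (3 * e ^ 2) := by rw [norm_mul]; gcongr; exact hq 2
    have e3 : ‖q 3 * (w₀ - c)‖ ≤ 1 * (3 * e ^ 2) := by rw [norm_mul]; gcongr; exact hq 3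
    have := norm_add_le (q 1 * (w₁ - z₁) + q 2 * w₂) (q 3 * (w₀ - c))
    have := norm_add_le (q 1 * (w₁ - z₁)) (q 2 * w₂)
    have h5 : e ^ 2 ≤ H ^ 2 * e := by
      have : H * e ≤ H ^ 2 * e := by
        have : 0 ≤ H * e := by positivity
        nlinarith
      nlinarith
    linarith
  have hid : amp a q w₁ w₂ w₀ - amp a q z₁ 0 c
      = (symb a w₀ - symb a c) * (q 0 + q 1 * w₁ + q 2 * w₂ + q 3 * w₀)
        + symb a c * (q 1 * (w₁ - z₁) + q 2 * w₂ + q 3 * (w₀ - c)) := by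
    unfold amp
    ring
  rw [hid]
  refine (norm_add_le _ _).trans ?_
  rw [norm_mul, norm_mul]
  calc _ ≤ (15 / (a ^ 4 * b ^ 2) * (H * e)) * (4 * H)
        + (2 / (a ^ 2 * b) * 1) * (9 * (H ^ 2 * e)) := by gcongr
    _ = _ := by ring

end Symbol
-- Rotation of the momentum plane by an imaginary angle.
section Boost
open MeasureTheory Set Filter Topology

/-- The horizontal momentum after a rotation by the imaginary angle `iβ`. -/
noncomputable def boostHoriz (β : ℝ) (u : ℂ) : ℂ :=
  (u.re * Real.cos β : ℝ) + Complex.I * (height u * Real.sin β : ℝ)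

/-- The vertical momentum after a rotation by the imaginary angle `iβ`. -/
noncomputable def boostVert (β : ℝ) (u : ℂ) : ℂ :=
  (height u * Real.cos β : ℝ) + Complex.I * (u.re * Real.sin β : ℝ)

/-- The Laplace-type integrand with phase direction `α`, on the momentum plane rotated by `iβ`. -/
noncomputable def boostIntegrand (a lam α : ℝ) (q : Fin 4 → ℂ) (β : ℝ) (u : ℂ) : ℂ :=
  (height u)⁻¹ • (Complex.exp (-(lam * ((height u * Real.cos (α - β) : ℝ)
    - Complex.I * (u.re * Real.sin (α - β) : ℝ)))) *
    amp a q (boostHoriz β u) u.im (boostVert β u))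

theorem norm_add_I_mul_sq (x y : ℝ) : ‖(x : ℂ) + Complex.I * y‖ ^ 2 = x ^ 2 + y ^ 2 := by
  rw [Complex.sq_norm, Complex.normSq_apply]
  simp
  ring

theorem sq_re_le_height_sq (u : ℂ) : u.re ^ 2 ≤ height u ^ 2 := by
  rw [height_sq]; nlinarith [sq_nonneg u.im]

theorem sq_im_le_height_sq (u : ℂ) : u.im ^ 2 ≤ height u ^ 2 := by
  rw [height_sq]; nlinarith [sq_nonneg u.re]

theorem height_pos (u : ℂ) : 0 < height u := one_pos.trans_le (one_le_height u)

theorem norm_boostHoriz_le (β : ℝ) (u : ℂ) : ‖boostHoriz β u‖ ≤ height u := by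
  refine (sq_le_sq₀ (norm_nonneg _) (height_pos u).le).1 ?_
  rw [boostHoriz, norm_add_I_mul_sq]
  nlinarith [sq_re_le_height_sq u, Real.sin_sq_add_cos_sq β, sq_nonneg (Real.cos β)]

theorem norm_boostVert_le (β : ℝ) (u : ℂ) : ‖boostVert β u‖ ≤ height u := by
  refine (sq_le_sq₀ (norm_nonneg _) (height_pos u).le).1 ?_
  rw [boostVert, norm_add_I_mul_sq]
  nlinarith [sq_re_le_height_sq u, Real.sin_sq_add_cos_sq β, sq_nonneg (Real.sin β)]

theorem norm_im_le_height (u : ℂ) : ‖(u.im : ℂ)‖ ≤ height u := by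
  refine (sq_le_sq₀ (norm_nonneg _) (height_pos u).le).1 ?_
  simpa using sq_im_le_height_sq u

theorem boostVert_re (β : ℝ) (u : ℂ) : (boostVert β u).re = height u * Real.cos β := by
  simp only [boostVert, Complex.add_re, Complex.ofReal_re, Complex.mul_re, Complex.I_re,
    Complex.ofReal_im, zero_mul, mul_zero, sub_zero, add_zero]

theorem norm_cexp_phase (lam x y : ℝ) :
    ‖Complex.exp (-(lam * ((x : ℂ) - Complex.I * y)))‖ = Real.exp (-(lam * x)) := by
  rw [Complex.norm_exp]
  simp

theorem measurable_boostIntegrand (a lam α : ℝ) (q : Fin 4 → ℂ) (β : ℝ) :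
    Measurable (boostIntegrand a lam α q β) := by
  have hh := continuous_height.measurable
  have h1 : Measurable (boostHoriz β) := by
    unfold boostHoriz
    fun_prop
  have h2 : Measurable (boostVert β) := by
    unfold boostVert
    fun_prop
  have h3 : Measurable fun u => symb a (boostVert β u) := (measurable_symb a).comp h2
  unfold boostIntegrand amp
  fun_prop

/-- Both `cos β` and `cos (α - β)` are at least `cos α`, so the bound is uniform over the strip
swept by the contour. -/
theorem norm_boostIntegrand_le {a lam α β : ℝ} (ha : 0 < a) (ha1 : a < 1) (hl : 0 < lam)
    {q : Fin 4 → ℂ} (hq : ∀ i, ‖q i‖ ≤ 1) (hα : α < Real.pi / 2) (hβ : 0 ≤ β) (hβα : β ≤ α)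
    (u : ℂ) : ‖boostIntegrand a lam α q β u‖ ≤ (height u)⁻¹ *
      (Real.exp (-(lam * Real.cos α * height u)) *
        (8 / (a ^ 2 * Real.cos α) * height u ^ 2)) := by
  have hc : 0 < Real.cos α := Real.cos_pos_of_mem_Ioo ⟨by linarith, hα⟩
  have hcβ : Real.cos α ≤ Real.cos β := Real.cos_le_cos_of_nonneg_of_le_pi hβ (by linarith) hβα
  have hcαβ : Real.cos α ≤ Real.cos (α - β) :=
    Real.cos_le_cos_of_nonneg_of_le_pi (by linarith) (by linarith) (by linarith)
  have hH := height_pos u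
  rw [boostIntegrand, norm_smul, norm_mul, norm_cexp_phase, Real.norm_eq_abs,
    abs_of_pos (inv_pos.2 hH)]
  gcongr ?_ * (?_ * ?_)
  · rw [Real.exp_le_exp, neg_le_neg_iff, mul_assoc]
    refine mul_le_mul_of_nonneg_left ?_ hl.le
    rw [mul_comm]
    exact mul_le_mul_of_nonneg_left hcαβ hH.le
  · refine norm_amp_le ha ha1 hc (one_le_height u) hq (norm_boostHoriz_le β u)
      (norm_im_le_height u) (norm_boostVert_le β u) ?_
    rw [boostVert_re, mul_comm]
    gcongr

theorem integrable_exp_height_mul_sq {lam : ℝ} (hl : 0 < lam) (K : ℝ) :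
    Integrable fun u : ℂ =>
      (height u)⁻¹ * (Real.exp (-(lam * height u)) * (K * height u ^ 2)) := by
  have h0 := integrable_exp_height hl le_rfl
  have h1 := integrable_exp_height hl zero_le_one
  have h2 := integrable_exp_height hl zero_le_two
  refine (((h0.add (h1.const_mul 2)).add h2).const_mul (Real.exp (-lam) * K)).congr
    (Eventually.of_forall fun u => ?_)
  have e : Real.exp (-(lam * height u)) = Real.exp (-lam) * Real.exp (-(lam * (height u - 1))) := by
    rw [← Real.exp_add]
    congr 1
    ring
  have hH := height_pos u
  simp only [Pi.add_apply, Real.rpow_zero, Real.rpow_one, Real.rpow_two, e]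
  field_simp
  ring

theorem integrable_boostIntegrand {a lam α β : ℝ} (ha : 0 < a) (ha1 : a < 1) (hl : 0 < lam)
    {q : Fin 4 → ℂ} (hq : ∀ i, ‖q i‖ ≤ 1) (hα : α < Real.pi / 2) (hβ : 0 ≤ β) (hβα : β ≤ α) :
    Integrable (boostIntegrand a lam α q β) := by
  have hc : 0 < Real.cos α := Real.cos_pos_of_mem_Ioo ⟨by linarith, hα⟩
  exact (integrable_exp_height_mul_sq (mul_pos hl hc) _).mono'
    (measurable_boostIntegrand a lam α q β).aestronglyMeasurable
    (Eventually.of_forall (norm_boostIntegrand_le ha ha1 hl hq hα hβ hβα))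

theorem height_mk (x y : ℝ) : height ⟨x, y⟩ = √((√(1 + y ^ 2)) ^ 2 + x ^ 2) := by
  rw [height, Complex.sq_norm, Complex.normSq_apply, Real.sq_sqrt (by positivity)]
  congr 1
  ring

/-- On the line `u₂ = y` the integrand is the restriction of an analytic function of
`t + iβ`, `u₁ = √(1 + y²) sinh t`. -/
noncomputable def stripIntegrand (a lam α : ℝ) (q : Fin 4 → ℂ) (y : ℝ) (z : ℂ) : ℂ :=
  Complex.exp (-(lam * (√(1 + y ^ 2) * Complex.cosh (z - α * Complex.I)))) *
    amp a q (√(1 + y ^ 2) * Complex.sinh z) y (√(1 + y ^ 2) * Complex.cosh z)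

theorem cosh_add_mul_I (t β : ℝ) : Complex.cosh (t + β * Complex.I)
    = (Real.cosh t * Real.cos β : ℝ) + Complex.I * (Real.sinh t * Real.sin β : ℝ) := by
  rw [Complex.cosh_add, Complex.cosh_mul_I, Complex.sinh_mul_I]
  push_cast
  ring

theorem sinh_add_mul_I (t β : ℝ) : Complex.sinh (t + β * Complex.I)
    = (Real.sinh t * Real.cos β : ℝ) + Complex.I * (Real.cosh t * Real.sin β : ℝ) := by
  rw [Complex.sinh_add, Complex.cosh_mul_I, Complex.sinh_mul_I]
  push_cast
  ring

theorem height_mul_sinh (t y : ℝ) :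
    height ⟨√(1 + y ^ 2) * Real.sinh t, y⟩ = √(1 + y ^ 2) * Real.cosh t := by
  rw [height_mk, sqrt_sq_add_mul_sinh_sq (by positivity)]

/-- By the addition formulas, translating `t` by `iβ` is the rotation of the momentum by `iβ`; the
factor `height` cancels the density of the invariant measure. -/
theorem stripIntegrand_eq (a lam α : ℝ) (q : Fin 4 → ℂ) (y t β : ℝ) :
    stripIntegrand a lam α q y (t + β * Complex.I)
      = height ⟨√(1 + y ^ 2) * Real.sinh t, y⟩ •
        boostIntegrand a lam α q β ⟨√(1 + y ^ 2) * Real.sinh t, y⟩ := by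
  have hH := height_pos ⟨√(1 + y ^ 2) * Real.sinh t, y⟩
  rw [boostIntegrand, smul_smul, mul_inv_cancel₀ hH.ne', one_smul, stripIntegrand, boostHoriz,
    boostVert, height_mul_sinh,
    show (t + β * Complex.I - α * Complex.I : ℂ) = t + ((β - α : ℝ) : ℂ) * Complex.I by
      push_cast; ring, cosh_add_mul_I, cosh_add_mul_I, sinh_add_mul_I,
    ← neg_sub α β, Real.cos_neg, Real.sin_neg]
  push_cast
  congr 1
  · congr 1
    ring
  · congr 1 <;> ring

theorem integral_boostIntegrand_line (a lam α : ℝ) (q : Fin 4 → ℂ) (β y : ℝ) :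
    ∫ x : ℝ, boostIntegrand a lam α q β ⟨x, y⟩
      = ∫ t : ℝ, stripIntegrand a lam α q y (t + β * Complex.I) := by
  have hm : 0 < √(1 + y ^ 2) := by positivity
  have := integral_comp_mul_sinh hm
    (fun x => height ⟨x, y⟩ • boostIntegrand a lam α q β ⟨x, y⟩)
  simp only [stripIntegrand_eq]
  rw [← this]
  refine integral_congr_ae (Eventually.of_forall fun x => ?_)
  simp only [← height_mk, smul_smul]
  rw [inv_mul_cancel₀ (height_pos _).ne', one_smul]

theorem integrable_boostIntegrand_line_iff (a lam α : ℝ) (q : Fin 4 → ℂ) (β y : ℝ) :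
    Integrable (fun x : ℝ => boostIntegrand a lam α q β ⟨x, y⟩) ↔
      Integrable fun t : ℝ => stripIntegrand a lam α q y (t + β * Complex.I) := by
  have hm : 0 < √(1 + y ^ 2) := by positivity
  have := integrable_comp_mul_sinh hm
    (fun x => height ⟨x, y⟩ • boostIntegrand a lam α q β ⟨x, y⟩)
  simp only [stripIntegrand_eq]
  rw [← this]
  refine integrable_congr (Eventually.of_forall fun x => ?_)
  simp only [← height_mk, smul_smul]
  rw [inv_mul_cancel₀ (height_pos _).ne', one_smul]

theorem differentiableAt_stripIntegrand {a lam α : ℝ} (ha : 0 < a) (hα : α < Real.pi / 2)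
    (hαa : Real.sin α ≤ a) (q : Fin 4 → ℂ) {y : ℝ} (hy : y ≠ 0) (t β : ℝ) (hβ : β ∈ Icc 0 α) :
    DifferentiableAt ℂ (stripIntegrand a lam α q y) (t + β * Complex.I) := by
  have hpi := Real.pi_pos
  have hcβ : 0 < Real.cos β := Real.cos_pos_of_mem_Ioo ⟨by linarith [hβ.1], by linarith [hβ.2]⟩
  have hsβ : 0 ≤ Real.sin β := Real.sin_nonneg_of_nonneg_of_le_pi hβ.1 (by linarith [hβ.2])
  have hsα : Real.sin β ≤ a :=
    (Real.sin_le_sin_of_le_of_le_pi_div_two (by linarith [hβ.1]) hα.le hβ.2).trans hαa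
  have hm : 1 < √(1 + y ^ 2) := Real.lt_sqrt_of_sq_lt (by
    have : 0 < y ^ 2 := by positivity
    linarith)
  have hH : 1 < √(1 + y ^ 2) * Real.cosh t := by
    nlinarith [Real.one_le_cosh t]
  have e : (√(1 + y ^ 2) : ℂ) * Complex.cosh (t + β * Complex.I)
      = ((√(1 + y ^ 2) * Real.cosh t : ℝ) : ℂ) * (Real.cos β : ℝ)
        + Complex.I * (((√(1 + y ^ 2) * Real.sinh t : ℝ) : ℂ) * (Real.sin β : ℝ)) := by
    rw [cosh_add_mul_I]
    push_cast
    ring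
  have hS : DifferentiableAt ℂ (symb a) (√(1 + y ^ 2) * Complex.cosh (t + β * Complex.I)) := by
    refine differentiableAt_symb ha ?_ ?_
    · rw [e, ← Complex.ofReal_mul, ← Complex.ofReal_mul]
      simp only [Complex.add_re, Complex.ofReal_re, Complex.mul_re, Complex.I_re, Complex.ofReal_im,
        zero_mul, mul_zero, sub_zero, add_zero]
      positivity
    · rw [e]
      exact sq_sub_mem_slitPlane hH hcβ (Real.cos_sq_add_sin_sq β) hsβ hsα
  have hS' : DifferentiableAt ℂ (fun z => symb a (√(1 + y ^ 2) * Complex.cosh z))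
      (t + β * Complex.I) :=
    DifferentiableAt.comp (g := symb a) _ hS (by fun_prop)
  unfold stripIntegrand amp
  fun_prop

theorem norm_stripIntegrand_le {a lam α β : ℝ} (ha : 0 < a) (ha1 : a < 1) (hl : 0 < lam)
    {q : Fin 4 → ℂ} (hq : ∀ i, ‖q i‖ ≤ 1) (hα : α < Real.pi / 2) (hβ : β ∈ Icc 0 α) (y t : ℝ) :
    ‖stripIntegrand a lam α q y (t + β * Complex.I)‖ ≤
      Real.exp (-(lam * Real.cos α * (√(1 + y ^ 2) * Real.cosh |t|))) *
        (8 / (a ^ 2 * Real.cos α) * (√(1 + y ^ 2) * Real.cosh |t|) ^ 2) := by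
  have h := norm_boostIntegrand_le ha ha1 hl hq hα hβ.1 hβ.2 ⟨√(1 + y ^ 2) * Real.sinh t, y⟩
  have hH := height_pos ⟨√(1 + y ^ 2) * Real.sinh t, y⟩
  rw [← div_eq_inv_mul, le_div_iff₀' hH] at h
  rw [stripIntegrand_eq, norm_smul, Real.norm_eq_abs, abs_of_pos hH, Real.cosh_abs]
  simpa only [height_mul_sinh] using h

theorem tendsto_strip_bound {c m K : ℝ} (hc : 0 < c) (hm : 0 < m) :
    Tendsto (fun T : ℝ => Real.exp (-(c * (m * Real.cosh T))) * (K * (m * Real.cosh T) ^ 2))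
      atTop (𝓝 0) := by
  have hcosh : Tendsto Real.cosh atTop atTop :=
    tendsto_atTop_mono (fun x => by
      rw [Real.cosh_eq]
      linarith [Real.exp_pos (-x)]) (Real.tendsto_exp_atTop.atTop_div_const two_pos)
  have h1 : Tendsto (fun T => m * Real.cosh T) atTop atTop := hcosh.const_mul_atTop hm
  have h2 := (tendsto_rpow_mul_exp_neg_mul_atTop_nhds_zero 2 c hc).comp h1
  have := h2.const_mul K
  rw [mul_zero] at this
  refine this.congr fun T => ?_
  simp only [Function.comp, Real.rpow_two, neg_mul]
  ring

theorem integral_complex_eq_iterated {f : ℂ → ℂ} (hf : Integrable f) :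
    (∫ u, f u = ∫ y : ℝ, ∫ x : ℝ, f ⟨x, y⟩) ∧ ∀ᵐ y : ℝ, Integrable fun x : ℝ => f ⟨x, y⟩ := by
  have hmp := Complex.volume_preserving_equiv_real_prod.symm
  have hi : Integrable (fun p : ℝ × ℝ => f (Complex.measurableEquivRealProd.symm p))
      ((volume : Measure ℝ).prod volume) :=
    (hmp.integrable_comp_emb Complex.measurableEquivRealProd.symm.measurableEmbedding).2 hf
  refine ⟨?_, hi.prod_left_ae⟩
  rw [← hmp.integral_comp' f]
  exact integral_prod_symm _ hi

/-- The rotation of the momentum plane by an imaginary angle does not change the integral. -/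
theorem integral_boostIntegrand {a lam α : ℝ} (ha : 0 < a) (ha1 : a < 1) (hl : 0 < lam)
    {q : Fin 4 → ℂ} (hq : ∀ i, ‖q i‖ ≤ 1) (hα0 : 0 ≤ α) (hα : α < Real.pi / 2)
    (hαa : Real.sin α ≤ a) :
    ∫ u, boostIntegrand a lam α q 0 u = ∫ u, boostIntegrand a lam α q α u := by
  have hc : 0 < Real.cos α := Real.cos_pos_of_mem_Ioo ⟨by linarith, hα⟩
  have h0 := integral_complex_eq_iterated (integrable_boostIntegrand ha ha1 hl hq hα le_rfl hα0)
  have h1 := integral_complex_eq_iterated (integrable_boostIntegrand ha ha1 hl hq hα hα0 le_rfl)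
  rw [h0.1, h1.1]
  -- The null line `y = 0` is discarded: when `sin α = a` its shifted contour meets the branch point
  -- at `t = 0`.
  have hne : ∀ᵐ y : ℝ, y ≠ 0 := by simp [ae_iff]
  refine integral_congr_ae ?_
  filter_upwards [h0.2, h1.2, hne] with y hy0 hy1 hy
  rw [integrable_boostIntegrand_line_iff] at hy0 hy1
  rw [integral_boostIntegrand_line, integral_boostIntegrand_line]
  simp only [Complex.ofReal_zero, zero_mul, add_zero] at hy0 ⊢
  exact integral_shift_of_decay hα0
    (fun t β hβ => differentiableAt_stripIntegrand ha hα hαa q hy t β hβ)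
    (fun t β hβ => norm_stripIntegrand_le ha ha1 hl hq hα hβ y t)
    (tendsto_strip_bound (mul_pos hl hc) (by positivity)) hy0 hy1

end Boost
-- Laplace asymptotics, uniform up to the critical angle.
section Asymptotics
open MeasureTheory Set Filter Topology

theorem boostIntegrand_self (a lam α : ℝ) (q : Fin 4 → ℂ) (u : ℂ) :
    boostIntegrand a lam α q α u = Complex.exp (-lam) *
      ((Real.exp (-(lam * (height u - 1))) * (height u - 1) ^ (0 : ℝ) / height u) •
        amp a q (boostHoriz α u) u.im (boostVert α u)) := by
  have e : Complex.exp (-(lam * ((height u * Real.cos (α - α) : ℝ)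
      - Complex.I * (u.re * Real.sin (α - α) : ℝ))))
      = Complex.exp (-lam) * Complex.exp (-(lam * (height u - 1))) := by
    rw [← Complex.exp_add, sub_self, Real.cos_zero, Real.sin_zero]
    congr 1
    push_cast
    ring
  rw [boostIntegrand, e, Real.rpow_zero, Complex.real_smul, Complex.real_smul]
  push_cast
  ring

/-- Each momentum component deviates from its saddle value by at most `√(2(H-1)H)`, since `(H² - 1)
+ (H-1)² = 2(H-1)H`. The Hölder estimate halves the exponent again; the power 13/4 absorbs the
growth of the amplitude at infinity. -/
theorem norm_amp_boost_sub_le {a b α : ℝ} (ha : 0 < a) (ha1 : a < 1) (hb : 0 < b)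
    (hbα : b ≤ Real.cos α) (hαa : Real.sin α ^ 2 ≤ a ^ 2)
    {q : Fin 4 → ℂ} (hq : ∀ i, ‖q i‖ ≤ 1) (u : ℂ) :
    ‖amp a q (boostHoriz α u) u.im (boostVert α u)
        - amp a q (Complex.I * Real.sin α) 0 (Real.cos α)‖ ≤
      4 * (60 / (a ^ 4 * b ^ 2) + 18 / (a ^ 2 * b)) *
        ((height u - 1) ^ (1 / 4 : ℝ) + (height u - 1) ^ (13 / 4 : ℝ)) := by
  have hH := one_le_height u
  have hHs := height_sq u
  have hcs := Real.sin_sq_add_cos_sq α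
  set H := height u with hHdef
  set c := Real.cos α
  set s := Real.sin α
  have hv : 0 ≤ H - 1 := by linarith
  -- Chosen so that `e⁴ = (H-1)H`, which makes every displacement at most `3e²`.
  set e : ℝ := ((H - 1) * H) ^ (1 / 4 : ℝ) with he
  have he0 : 0 ≤ e := by positivity
  have he4 : e ^ 4 = (H - 1) * H := by
    rw [he, ← Real.rpow_natCast, ← Real.rpow_mul (by positivity)]
    norm_num
  have heH : e ≤ H := by
    refine (pow_le_pow_iff_left₀ he0 (by linarith) four_ne_zero).1 ?_
    rw [he4]
    calc (H - 1) * H ≤ H * H := by gcongr; linarith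
      _ = H ^ 2 := by ring
      _ ≤ H ^ 4 := pow_le_pow_right₀ hH (by norm_num)
  have key : ∀ w : ℂ, ‖w‖ ^ 2 ≤ 2 * ((H - 1) * H) → ‖w‖ ≤ 3 * e ^ 2 := by
    intro w hw
    refine (sq_le_sq₀ (norm_nonneg _) (by positivity)).1 (hw.trans ?_)
    rw [← he4]
    nlinarith [pow_nonneg he0 4]
  have h1 : ‖boostHoriz α u - Complex.I * s‖ ≤ 3 * e ^ 2 := by
    apply key
    rw [show boostHoriz α u - Complex.I * s
      = ((u.re * c : ℝ) : ℂ) + Complex.I * (((H - 1) * s : ℝ) : ℂ) by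
        change ((u.re * c : ℝ) : ℂ) + Complex.I * ((H * s : ℝ) : ℂ) - _ = _
        push_cast
        ring, norm_add_I_mul_sq]
    nlinarith [mul_nonneg (sq_nonneg u.re) (sq_nonneg s), sq_nonneg u.im,
      mul_nonneg (sq_nonneg (H - 1)) (sq_nonneg c)]
  have h0 : ‖boostVert α u - c‖ ≤ 3 * e ^ 2 := by
    apply key
    rw [show boostVert α u - c
      = (((H - 1) * c : ℝ) : ℂ) + Complex.I * ((u.re * s : ℝ) : ℂ) by
        change ((H * c : ℝ) : ℂ) + Complex.I * ((u.re * s : ℝ) : ℂ) - _ = _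
        push_cast
        ring, norm_add_I_mul_sq]
    nlinarith [mul_nonneg (sq_nonneg u.re) (sq_nonneg c), sq_nonneg u.im,
      mul_nonneg (sq_nonneg (H - 1)) (sq_nonneg s)]
  have h2 : ‖(u.im : ℂ)‖ ≤ 3 * e ^ 2 := by
    apply key
    rw [Complex.norm_real, Real.norm_eq_abs, sq_abs]
    nlinarith [sq_nonneg u.re, sq_nonneg (H - 1)]
  have hmain := norm_amp_sub_le ha ha1 hb hbα (Real.cos_le_one α) (by linarith) hH he0 heH hq
    (norm_boostHoriz_le α u) (norm_im_le_height u) (norm_boostVert_le α u)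
    (by rw [boostVert_re, mul_comm]; gcongr) h1 h2 h0
  refine hmain.trans ?_
  have hC : 0 ≤ 60 / (a ^ 4 * b ^ 2) + 18 / (a ^ 2 * b) := by positivity
  rw [mul_comm (4 : ℝ), mul_assoc]
  refine mul_le_mul_of_nonneg_left ?_ hC
  have he' : e ≤ (H - 1) ^ (1 / 4 : ℝ) * H := by
    rw [he, Real.mul_rpow hv (by linarith)]
    gcongr
    exact (Real.rpow_le_rpow_of_exponent_le hH (by norm_num)).trans_eq (Real.rpow_one H)
  have hpow : (H - 1) ^ (13 / 4 : ℝ) = (H - 1) ^ (1 / 4 : ℝ) * (H - 1) ^ 3 := by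
    rw [← Real.rpow_natCast (H - 1) 3, ← Real.rpow_add_of_nonneg hv (by norm_num) (by norm_num)]
    norm_num
  rw [hpow]
  have hr : 0 ≤ (H - 1) ^ (1 / 4 : ℝ) := by positivity
  -- The difference of the two sides is `3H(H-2)²`.
  have h3 : H ^ 3 ≤ 4 * (1 + (H - 1) ^ 3) := by
    nlinarith [mul_nonneg (show 0 ≤ H by linarith) (sq_nonneg (H - 2))]
  calc H ^ 2 * e ≤ H ^ 2 * ((H - 1) ^ (1 / 4 : ℝ) * H) := by gcongr
    _ = (H - 1) ^ (1 / 4 : ℝ) * H ^ 3 := by ring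
    _ ≤ (H - 1) ^ (1 / 4 : ℝ) * (4 * (1 + (H - 1) ^ 3)) := by gcongr
    _ = _ := by ring

/-- Laplace asymptotics, uniform up to the critical angle `sin α = a`. -/
theorem norm_laplace_sub_le {a b lam α : ℝ} (ha : 0 < a) (ha1 : a < 1) (hb : 0 < b)
    (hl : 0 < lam) (hα0 : 0 ≤ α) (hα : α < Real.pi / 2) (hαa : Real.sin α ≤ a)
    (hbα : b ≤ Real.cos α) {q : Fin 4 → ℂ} (hq : ∀ i, ‖q i‖ ≤ 1) :
    ‖(lam * Complex.exp lam / (2 * Real.pi)) * (∫ u, boostIntegrand a lam α q 0 u)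
        - amp a q (Complex.I * Real.sin α) 0 (Real.cos α)‖ ≤
      4 * (60 / (a ^ 4 * b ^ 2) + 18 / (a ^ 2 * b)) *
        (Real.Gamma (5 / 4) * (1 / lam) ^ (1 / 4 : ℝ)
          + Real.Gamma (17 / 4) * (1 / lam) ^ (13 / 4 : ℝ)) := by
  set C : ℝ := 4 * (60 / (a ^ 4 * b ^ 2) + 18 / (a ^ 2 * b)) with hC
  set F₀ := amp a q (Complex.I * Real.sin α) 0 (Real.cos α) with hF₀
  set F : ℂ → ℂ := fun u => amp a q (boostHoriz α u) u.im (boostVert α u) with hF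
  set W : ℝ → ℂ → ℝ := fun s u =>
    Real.exp (-(lam * (height u - 1))) * (height u - 1) ^ s / height u with hW
  have hpi := Real.pi_pos
  have hs2 : Real.sin α ^ 2 ≤ a ^ 2 :=
    pow_le_pow_left₀ (Real.sin_nonneg_of_nonneg_of_le_pi hα0 (by linarith)) hαa 2
  have hexp : Complex.exp lam * Complex.exp (-lam) = 1 := by
    rw [← Complex.exp_add, add_neg_cancel, Complex.exp_zero]
  have hWF : ∀ u, boostIntegrand a lam α q α u = Complex.exp (-lam) * (W 0 u • F u) :=
    fun u => boostIntegrand_self a lam α q u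
  have hWFi : Integrable fun u => W 0 u • F u := by
    refine ((integrable_boostIntegrand ha ha1 hl hq hα hα0 le_rfl).const_mul
      (Complex.exp lam)).congr (Eventually.of_forall fun u => ?_)
    simp only [hWF]
    rw [← mul_assoc, hexp, one_mul]
  have hW0i : Integrable fun u => W 0 u • F₀ := (integrable_exp_height hl le_rfl).smul_const F₀
  have hW0 : ∫ u, W 0 u = 2 * Real.pi / lam := by
    rw [integral_exp_height hl le_rfl]
    simp
    ring
  have hlc : (lam : ℂ) ≠ 0 := by exact_mod_cast hl.ne'
  have hpc : (Real.pi : ℂ) ≠ 0 := by exact_mod_cast hpi.ne'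
  -- The weight `W 0` has total mass exactly `2π/λ`, so `F₀` can be subtracted under the integral.
  have hid : (lam * Complex.exp lam / (2 * Real.pi)) * (∫ u, boostIntegrand a lam α q 0 u) - F₀
      = (lam / (2 * Real.pi) : ℝ) * ∫ u, W 0 u • (F u - F₀) := by
    simp only [smul_sub]
    rw [integral_boostIntegrand ha ha1 hl hq hα0 hα hαa, integral_sub hWFi hW0i,
      integral_smul_const, hW0]
    simp only [hWF]
    rw [integral_const_mul, Complex.real_smul]
    push_cast
    have e : (lam / (2 * Real.pi) : ℂ) * ((2 * Real.pi / lam) * F₀) = F₀ := by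
      field_simp
    rw [mul_sub, e]
    congr 1
    linear_combination (lam / (2 * Real.pi) * ∫ u, W 0 u • F u : ℂ) * hexp
  have hbd : ‖∫ u, W 0 u • (F u - F₀)‖ ≤ ∫ u, C * (W (1 / 4) u + W (13 / 4) u) := by
    have i1 := integrable_exp_height hl (show (0 : ℝ) ≤ 1 / 4 by norm_num)
    have i2 := integrable_exp_height hl (show (0 : ℝ) ≤ 13 / 4 by norm_num)
    refine norm_integral_le_of_norm_le ((i1.add i2).const_mul C) (Eventually.of_forall fun u => ?_)
    have hH := height_pos u
    have := norm_amp_boost_sub_le ha ha1 hb hbα hs2 hq u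
    rw [norm_smul, Real.norm_eq_abs, abs_of_nonneg (by simp only [hW, Real.rpow_zero]; positivity)]
    simp only [hW, Real.rpow_zero, mul_one]
    calc _ ≤ Real.exp (-(lam * (height u - 1))) / height u *
          (C * ((height u - 1) ^ (1 / 4 : ℝ) + (height u - 1) ^ (13 / 4 : ℝ))) := by gcongr
      _ = _ := by ring
  rw [hid, norm_mul, Complex.norm_real, Real.norm_eq_abs, abs_of_pos (by positivity)]
  rw [integral_const_mul, integral_add (integrable_exp_height hl (by norm_num))
    (integrable_exp_height hl (by norm_num)), integral_exp_height hl (by norm_num),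
    integral_exp_height hl (by norm_num)] at hbd
  refine (mul_le_mul_of_nonneg_left hbd (by positivity)).trans_eq ?_
  have hr : ∀ s : ℝ, (1 / lam) ^ (s + 1) = (1 / lam) ^ s * (1 / lam) := fun s => by
    rw [Real.rpow_add (by positivity), Real.rpow_one]
  rw [hr, hr]
  norm_num
  field_simp

end Asymptotics
-- Reduction of the Fourier integral to the hyperboloid, and differentiation in `x`.
section Reduction
open MeasureTheory Set Filter Topology

theorem horiz_join (p : E2) (s : ℝ) : horiz (join p s) = p := by
  ext i
  fin_cases i <;> simp [horiz, join]

theorem norm_E3_sq (X : E3) : ‖X‖ ^ 2 = ‖horiz X‖ ^ 2 + X 2 ^ 2 := by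
  simp [EuclideanSpace.norm_sq_eq, horiz, Fin.sum_univ_three, Fin.sum_univ_two]

theorem inner_join (p : E2) (s : ℝ) (X : E3) :
    inner ℝ (join p s) X = inner ℝ p (horiz X) + s * X 2 := by
  simp [PiLp.inner_apply, join, horiz, Fin.sum_univ_three, Fin.sum_univ_two]
  ring

theorem horiz_add_smul (X Y : E3) (t : ℝ) : horiz (X + t • Y) = horiz X + t • horiz Y := by
  ext i
  fin_cases i <;> simp [horiz]

theorem sub_lift_apply_two (x : E3) (z : E2) : (x - lift z) 2 = x 2 := by
  simp [lift, join]

theorem horiz_sub_lift (x : E3) (z : E2) : horiz (x - lift z) = horiz x - z := by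
  ext i
  fin_cases i <;> simp [horiz, lift, join]

/-- The exponent of the plane wave with horizontal momentum `w` and vertical momentum `i h`. -/
noncomputable def phase (X : E3) (w : E2) (h : ℝ) : ℂ :=
  Complex.I * (inner ℝ w (horiz X) : ℝ) + (X 2 * h : ℝ)

theorem phase_add_smul (X Y : E3) (w : E2) (h t : ℝ) :
    phase (X + t • Y) w h = phase X w h + t * phase Y w h := by
  rw [phase, phase, phase, horiz_add_smul, inner_add_right, inner_smul_right]
  simp only [PiLp.add_apply, PiLp.smul_apply, smul_eq_mul]
  push_cast
  ring

/-- The denominator is `γ₋ (s² + (h/√γ₋)²)`, a Lorentzian in `s`. Since `x₃ < 0`, the factor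
`e^{-A|τx₃|}` is the exponential of a linear function of `x₃`, hence part of `phase`. -/
theorem integral_refractedIntegrand {γp γm τ : ℝ} (hγm : 0 < γm) (hτ : 0 < τ) {x : E3}
    (hx : x 2 < 0) (z : E2) (ξ : E2) :
    ∫ s : ℝ, refractedIntegrand γp γm τ x z (join ξ s)
      = (4 * Real.pi : ℝ) * (Complex.exp ((τ / √γm : ℝ) *
          phase (x - lift z) (√γm • ξ) √(1 + ‖√γm • ξ‖ ^ 2)) *
        ((√(1 + ‖√γm • ξ‖ ^ 2))⁻¹ • symb (a0 γp γm) √(1 + ‖√γm • ξ‖ ^ 2))) := by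
  set X := x - lift z with hX
  have hX2 : X 2 < 0 := by rwa [hX, sub_lift_apply_two]
  have hg : 0 < √γm := Real.sqrt_pos.2 hγm
  have hgs : √γm ^ 2 = γm := Real.sq_sqrt hγm.le
  have hnorm : ‖√γm • ξ‖ = √γm * ‖ξ‖ := by rw [norm_smul, Real.norm_of_nonneg hg.le]
  set h := √(1 + ‖√γm • ξ‖ ^ 2) with hh
  have hh0 : 0 < h := by positivity
  have hh2 : h ^ 2 = 1 + γm * ‖ξ‖ ^ 2 := by
    rw [hh, Real.sq_sqrt (by positivity), hnorm, mul_pow, hgs]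
  have hA : 0 < h / √γm := by positivity
  have hT : transCoeff γp γm (√γm * ‖ξ‖) = 4 * √γm * (√(a0 γp γm ^ 2 + (√γm * ‖ξ‖) ^ 2) * h /
      (√(a0 γp γm ^ 2 + (√γm * ‖ξ‖) ^ 2) + a0 γp γm ^ 2 * h)) := by
    rw [transCoeff, hh, hnorm]
    ring
  have hS : symb (a0 γp γm) h = ((√(a0 γp γm ^ 2 + (√γm * ‖ξ‖) ^ 2) * h /
      (√(a0 γp γm ^ 2 + (√γm * ‖ξ‖) ^ 2) + a0 γp γm ^ 2 * h) : ℝ) : ℂ) := by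
    rw [hh, hnorm, symb_ofReal]
  have hpt : ∀ s : ℝ, refractedIntegrand γp γm τ x z (join ξ s)
      = (Complex.exp (Complex.I * (τ * inner ℝ ξ (horiz X) : ℝ)) *
          (1 / γm * transCoeff γp γm (√γm * ‖ξ‖) : ℝ)) *
        (Complex.exp (Complex.I * ((τ * X 2 * s : ℝ) : ℂ)) *
          ((1 / (s ^ 2 + (h / √γm) ^ 2) : ℝ) : ℂ)) := by
    intro s
    have e1 : Complex.exp (Complex.I * ((τ * inner ℝ (join ξ s) X : ℝ) : ℂ))
        = Complex.exp (Complex.I * (τ * inner ℝ ξ (horiz X) : ℝ)) *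
          Complex.exp (Complex.I * ((τ * X 2 * s : ℝ) : ℂ)) := by
      rw [← Complex.exp_add, inner_join]
      congr 1
      push_cast
      ring
    have e2 : 1 / (γm * ‖join ξ s‖ ^ 2 + 1) = 1 / γm * (1 / (s ^ 2 + (h / √γm) ^ 2)) := by
      have hj2 : (join ξ s) 2 = s := by simp [join]
      rw [norm_E3_sq, horiz_join, hj2, div_pow, hgs, hh2, one_div_mul_one_div]
      congr 1
      field_simp
      ring
    rw [refractedIntegrand, ← hX, e1, e2, horiz_join]
    push_cast
    ring
  simp only [hpt]
  rw [integral_const_mul, integral_cexp_mul_I_div_sq_add_sq hA, hT, hS]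
  generalize √(a0 γp γm ^ 2 + (√γm * ‖ξ‖) ^ 2) * h /
      (√(a0 γp γm ^ 2 + (√γm * ‖ξ‖) ^ 2) + a0 γp γm ^ 2 * h) = S
  have e3 : Complex.exp ((τ / √γm : ℝ) * phase X (√γm • ξ) h)
      = Complex.exp (Complex.I * (τ * inner ℝ ξ (horiz X) : ℝ)) *
        (Real.exp (-(h / √γm) * |τ * X 2|) : ℝ) := by
    rw [Complex.ofReal_exp, ← Complex.exp_add, phase, real_inner_smul_left,
      abs_of_neg (mul_neg_of_pos_of_neg hτ hX2)]
    congr 1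
    have : (√γm : ℂ) ≠ 0 := by exact_mod_cast hg.ne'
    push_cast
    field_simp
  rw [e3, Complex.real_smul]
  have hgc : (√γm : ℂ) ≠ 0 := by exact_mod_cast hg.ne'
  have hhc : (h : ℂ) ≠ 0 := by exact_mod_cast hh0.ne'
  have hgsc : (√γm : ℂ) ^ 2 = γm := by exact_mod_cast hgs
  have hgmc : (γm : ℂ) ≠ 0 := by exact_mod_cast hγm.ne'
  push_cast
  rw [← hgsc]
  field_simp

/-- Rescaling by `√γ₋` in two dimensions produces `1/γ₋`. The isometry `L` is left free so that it
can later be aligned with `X'`. -/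
theorem refractedPart_eq {γp γm τ : ℝ} (hγm : 0 < γm) (hτ : 0 < τ) {x : E3}
    (hx : x 2 < 0) (z : E2) (L : ℂ ≃ₗᵢ[ℝ] E2) :
    refractedPart γp γm τ x z = (τ / (2 * Real.pi ^ 2 * γm) : ℝ) *
      ∫ u : ℂ, Complex.exp ((τ / √γm : ℝ) * phase (x - lift z) (L u) (height u)) *
        ((height u)⁻¹ • symb (a0 γp γm) (height u)) := by
  have hg : 0 < √γm := Real.sqrt_pos.2 hγm
  have hgs : √γm ^ 2 = γm := Real.sq_sqrt hγm.le
  set f : E2 → ℂ := fun w => Complex.exp ((τ / √γm : ℝ) *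
      phase (x - lift z) w √(1 + ‖w‖ ^ 2)) *
        ((√(1 + ‖w‖ ^ 2))⁻¹ • symb (a0 γp γm) √(1 + ‖w‖ ^ 2)) with hf
  have h1 : ∫ u : ℂ, Complex.exp ((τ / √γm : ℝ) * phase (x - lift z) (L u) (height u)) *
        ((height u)⁻¹ • symb (a0 γp γm) (height u)) = ∫ w, f w := by
    rw [← L.measurePreserving.integral_comp L.toHomeomorph.measurableEmbedding f]
    simp only [hf, L.norm_map]
    rfl
  have h2 := Measure.integral_comp_smul (volume : Measure E2) f √γm
  rw [refractedPart, h1]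
  simp only [integral_refractedIntegrand hγm hτ hx]
  rw [integral_const_mul, h2, finrank_euclideanSpace_fin, hgs, abs_of_pos (by positivity),
    Complex.real_smul]
  have hgmc : (γm : ℂ) ≠ 0 := by exact_mod_cast hγm.ne'
  have hpc : (Real.pi : ℂ) ≠ 0 := by exact_mod_cast Real.pi_ne_zero
  push_cast
  field_simp
  ring

theorem norm_phase_single_le (k : Fin 3) {w : E2} {h : ℝ} (hw : ‖w‖ ≤ h) :
    ‖phase (EuclideanSpace.single k 1) w h‖ ≤ h := by
  have h0 : 0 ≤ h := (norm_nonneg _).trans hw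
  have hc : ∀ i, |w i| ≤ h := fun i => (PiLp.norm_apply_le w i).trans hw
  fin_cases k <;> simp [phase, horiz, PiLp.inner_apply, Fin.sum_univ_two, hc, abs_of_nonneg h0]

theorem phase_re (X : E3) (w : E2) (h : ℝ) : (phase X w h).re = X 2 * h := by
  simp only [phase, Complex.add_re, Complex.ofReal_re, Complex.mul_re, Complex.I_re,
    Complex.ofReal_im, zero_mul, mul_zero, sub_zero, Complex.I_im, zero_add]

theorem norm_le_height (u : ℂ) : ‖u‖ ≤ height u :=
  Real.le_sqrt_of_sq_le (by linarith)

theorem measurable_phase (X : E3) (L : ℂ ≃ₗᵢ[ℝ] E2) :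
    Measurable fun u => phase X (L u) (height u) := by
  have hL : Continuous L := L.continuous
  have hh := continuous_height
  unfold phase
  exact Continuous.measurable (by fun_prop)

/-- Differentiation of the plane wave superposition under the integral sign. -/
theorem hasDerivAt_integral_phase {a κ : ℝ} (ha : 0 < a) (ha1 : a < 1) (hκ : 0 < κ) {X : E3}
    (hX : X 2 < 0) (L : ℂ ≃ₗᵢ[ℝ] E2) (k : Fin 3) :
    HasDerivAt (fun t : ℝ => ∫ u : ℂ,
        Complex.exp (κ * phase (X + t • EuclideanSpace.single k (1 : ℝ)) (L u) (height u)) *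
          ((height u)⁻¹ • symb a (height u)))
      (∫ u : ℂ, κ * phase (EuclideanSpace.single k 1) (L u) (height u) *
        (Complex.exp (κ * phase X (L u) (height u)) * ((height u)⁻¹ • symb a (height u)))) 0 := by
  set Y : E3 := EuclideanSpace.single k (1 : ℝ) with hY
  have hY2 : |Y 2| ≤ 1 := by
    rw [hY]
    fin_cases k <;> simp
  set S : ℂ → ℂ := fun u => (height u)⁻¹ • symb a (height u) with hS
  have hSm : Measurable S := by
    have := continuous_height.measurable
    exact (this.inv).smul ((measurable_symb a).comp (Complex.measurable_ofReal.comp this))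
  have hSb : ∀ u, ‖S u‖ ≤ (height u)⁻¹ * (2 / a ^ 2 * height u) := fun u => by
    have hH := height_pos u
    have := norm_symb_le ha ha1 one_pos (one_le_height u) (p := height u)
      (by rw [Complex.norm_real, Real.norm_of_nonneg hH.le]) (by simp)
    rw [hS, norm_smul, Real.norm_of_nonneg (inv_nonneg.2 hH.le)]
    rw [mul_one] at this
    gcongr
  set F : ℝ → ℂ → ℂ := fun t u => Complex.exp (κ * phase (X + t • Y) (L u) (height u)) * S u
  set F' : ℝ → ℂ → ℂ := fun t u => κ * phase Y (L u) (height u) *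
    (Complex.exp (κ * phase (X + t • Y) (L u) (height u)) * S u) with hF'
  have hFm : ∀ t, Measurable (F t) := fun t =>
    (Complex.measurable_exp.comp ((measurable_phase _ L).const_mul _)).mul hSm
  have hF'm : Measurable (F' 0) := ((measurable_phase Y L).const_mul _).mul (hFm 0)
  -- For `|t| < -X₃/2` the third coordinate stays below `X₃/2`, so `η` is a decay rate uniform in
  -- `t`.
  set η := κ * (-X 2 / 2) with hη
  have hη0 : 0 < η := by
    have : 0 < -X 2 / 2 := by linarith
    positivity
  have hFb : ∀ t ∈ Metric.ball (0 : ℝ) (-X 2 / 2), ∀ u,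
      ‖F t u‖ ≤ Real.exp (-(η * height u)) * ((height u)⁻¹ * (2 / a ^ 2 * height u)) := by
    intro t ht u
    have hH := height_pos u
    have ht' : |t| < -X 2 / 2 := by simpa using ht
    rw [norm_mul]
    gcongr
    · rw [Complex.norm_exp, Real.exp_le_exp, Complex.re_ofReal_mul, phase_re]
      have h1 : t * Y 2 ≤ |t| := by
        calc t * Y 2 ≤ |t * Y 2| := le_abs_self _
          _ = |t| * |Y 2| := abs_mul _ _
          _ ≤ |t| * 1 := by gcongr
          _ = |t| := mul_one _
      have h2 : (X + t • Y) 2 ≤ -(-X 2 / 2) := by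
        simp only [PiLp.add_apply, PiLp.smul_apply, smul_eq_mul]
        linarith
      rw [hη]
      have := mul_le_mul_of_nonneg_left (mul_le_mul_of_nonneg_right h2 hH.le) hκ.le
      linarith
    · exact hSb u
  have h0mem : (0 : ℝ) ∈ Metric.ball (0 : ℝ) (-X 2 / 2) :=
    Metric.mem_ball_self (by linarith)
  have hres := hasDerivAt_integral_of_dominated_loc_of_deriv_le (μ := volume) (F := F) (F' := F')
    (x₀ := (0 : ℝ)) (s := Metric.ball (0 : ℝ) (-X 2 / 2))
    (bound := fun u => (height u)⁻¹ * (Real.exp (-(η * height u)) *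
      (κ * (2 / a ^ 2) * height u ^ 2)))
    (Metric.ball_mem_nhds _ (by linarith))
    (Eventually.of_forall fun t => (hFm t).aestronglyMeasurable)
    ((integrable_exp_height_mul_sq hη0 (2 / a ^ 2)).mono' (hFm 0).aestronglyMeasurable
      (Eventually.of_forall fun u => (hFb 0 h0mem u).trans (by
        have hH := height_pos u
        have : height u ≤ height u ^ 2 := by nlinarith [one_le_height u]
        calc _ = (height u)⁻¹ * (Real.exp (-(η * height u)) * (2 / a ^ 2 * height u)) := by ring
          _ ≤ _ := by gcongr)))
    hF'm.aestronglyMeasurable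
    (Eventually.of_forall fun u t ht => by
      have hH := height_pos u
      have hp : ‖phase Y (L u) (height u)‖ ≤ height u :=
        norm_phase_single_le k (by rw [L.norm_map]; exact norm_le_height u)
      rw [hF', norm_mul, norm_mul, Complex.norm_real, Real.norm_of_nonneg hκ.le]
      calc _ ≤ κ * height u * (Real.exp (-(η * height u)) *
            ((height u)⁻¹ * (2 / a ^ 2 * height u))) := by
            gcongr
            exact hFb t ht u
        _ = _ := by ring)
    (integrable_exp_height_mul_sq hη0 _)
    (Eventually.of_forall fun u t _ => by
      have h1 : HasDerivAt (fun t : ℝ => κ * phase (X + t • Y) (L u) (height u))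
          (κ * phase Y (L u) (height u)) t := by
        simp only [phase_add_smul]
        have h2 : HasDerivAt (fun t : ℝ => (t : ℂ)) 1 t := Complex.ofRealCLM.hasDerivAt
        refine (((h2.mul_const (phase Y (L u) (height u))).const_add
          (phase X (L u) (height u))).const_mul (κ : ℂ)).congr_deriv ?_
        ring
      refine ((h1.cexp).mul_const (S u)).congr_deriv ?_
      rw [hF']
      ring)
  have := hres.2
  simp only [F, F', zero_smul, add_zero] at this
  exact this

theorem hasPartialAt_refractedPart {γp γm τ : ℝ} (hγm : 0 < γm) (hτ : 0 < τ)
    (ha : 0 < a0 γp γm) (ha1 : a0 γp γm < 1) {x : E3} (hx : x 2 < 0) (z : E2)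
    (L : ℂ ≃ₗᵢ[ℝ] E2) (k : Fin 3) :
    HasPartialAt (fun y => refractedPart γp γm τ y z) k
      ((τ / (2 * Real.pi ^ 2 * γm) : ℝ) * ∫ u : ℂ, (τ / √γm : ℝ) *
        phase (EuclideanSpace.single k 1) (L u) (height u) *
        (Complex.exp ((τ / √γm : ℝ) * phase (x - lift z) (L u) (height u)) *
          ((height u)⁻¹ • symb (a0 γp γm) (height u)))) x := by
  have hg : 0 < √γm := Real.sqrt_pos.2 hγm
  have h := (hasDerivAt_integral_phase ha ha1 (div_pos hτ hg) (X := x - lift z)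
    (by rwa [sub_lift_apply_two]) L k).const_mul ((τ / (2 * Real.pi ^ 2 * γm) : ℝ) : ℂ)
  refine h.congr_of_eventuallyEq ?_
  have hcont : Continuous fun t : ℝ => (x + t • EuclideanSpace.single k (1 : ℝ) : E3) 2 := by
    simp only [PiLp.add_apply, PiLp.smul_apply, smul_eq_mul]
    fun_prop
  -- The integral representation needs a negative third coordinate, which persists for small `t`.
  have hev : ∀ᶠ t in 𝓝 (0 : ℝ), (x + t • EuclideanSpace.single k (1 : ℝ) : E3) 2 < 0 :=
    hcont.continuousAt.eventually_lt continuousAt_const (by simpa using hx)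
  filter_upwards [hev] with t ht
  rw [refractedPart_eq hγm hτ ht z L]
  simp only [add_sub_right_comm]

end Reduction
-- Geometry of the cone, leading amplitudes and assembly.
section Main
open MeasureTheory Set Filter Topology

theorem a0_pos {γp γm : ℝ} (hγm : 0 < γm) (hγ : γm < γp) : 0 < a0 γp γm :=
  Real.sqrt_pos.2 (div_pos hγm (hγm.trans hγ))

theorem a0_lt_one {γp γm : ℝ} (hγm : 0 < γm) (hγ : γm < γp) : a0 γp γm < 1 := by
  rw [a0, Real.sqrt_lt' one_pos, one_pow, div_lt_one (hγm.trans hγ)]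
  exact hγ

theorem norm_sub_lift (x : E3) (z : E2) :
    ‖x - lift z‖ = √(‖horiz x - z‖ ^ 2 + x 2 ^ 2) := by
  rw [← horiz_sub_lift, ← sub_lift_apply_two x z, ← norm_E3_sq, Real.sqrt_sq (norm_nonneg _)]

/-- Both inequalities are closed conditions on `z` and hold on the difference of the cones. The
upper one becomes `sin α ≤ a₀`; the lower one gives `X' ≠ 0`. -/
theorem bounds_of_mem_closure {γp γm δ : ℝ} {x : E3} {z : E2}
    (hz : z ∈ closure (cone γp γm 1 x \ cone γp γm δ x)) :
    a0 γp γm * δ * ‖x - lift z‖ ≤ ‖horiz (x - lift z)‖ ∧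
      ‖horiz (x - lift z)‖ ≤ a0 γp γm * ‖x - lift z‖ := by
  have hcl : IsClosed {z : E2 | a0 γp γm * δ * ‖x - lift z‖ ≤ ‖horiz (x - lift z)‖ ∧
      ‖horiz (x - lift z)‖ ≤ a0 γp γm * ‖x - lift z‖} := by
    simp only [horiz_sub_lift, norm_sub_lift]
    have h1 : Continuous fun z : E2 => ‖horiz x - z‖ := by fun_prop
    have h2 : Continuous fun z : E2 => √(‖horiz x - z‖ ^ 2 + x 2 ^ 2) := by fun_prop
    exact (isClosed_le (h2.const_mul _) h1).inter (isClosed_le h1 (h2.const_mul _))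
  refine closure_minimal ?_ hcl hz
  rintro z ⟨h1, h2⟩
  simp only [cone, mem_ofPred_eq, not_lt, mul_one, ← horiz_sub_lift] at h1 h2
  exact ⟨h2, h1.le⟩

/-- A linear isometry from the complex plane which maps the real axis to the direction of `w`. -/
theorem exists_adapted_isometry {w : E2} (hw : w ≠ 0) :
    ∃ (L : ℂ ≃ₗᵢ[ℝ] E2) (o₁ o₂ : ℝ), o₁ ^ 2 + o₂ ^ 2 = 1 ∧ w 0 = ‖w‖ * o₁ ∧ w 1 = ‖w‖ * o₂ ∧
      ∀ u, (L u) 0 = o₁ * u.re - o₂ * u.im ∧ (L u) 1 = o₂ * u.re + o₁ * u.im := by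
  have hn : 0 < ‖w‖ := norm_pos_iff.2 hw
  have hw2 : ‖w‖ ^ 2 = w 0 ^ 2 + w 1 ^ 2 := by
    simp [EuclideanSpace.norm_sq_eq, Fin.sum_univ_two]
  have ho : (w 0 / ‖w‖) ^ 2 + (w 1 / ‖w‖) ^ 2 = 1 := by
    rw [div_pow, div_pow, ← add_div, ← hw2, div_self (by positivity)]
  let c : Circle := ⟨⟨w 0 / ‖w‖, w 1 / ‖w‖⟩, by
    refine mem_sphere_zero_iff_norm.2 ?_
    have : ‖(⟨w 0 / ‖w‖, w 1 / ‖w‖⟩ : ℂ)‖ ^ 2 = 1 := by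
      rw [Complex.sq_norm, Complex.normSq_apply, ← ho]
      ring
    exact (pow_eq_one_iff_of_nonneg (norm_nonneg _) two_ne_zero).1 this⟩
  refine ⟨(rotation c).trans Complex.orthonormalBasisOneI.repr, w 0 / ‖w‖, w 1 / ‖w‖, ho,
    by field_simp, by field_simp, fun u => ?_⟩
  have hc : rotation c u = (⟨w 0 / ‖w‖, w 1 / ‖w‖⟩ : ℂ) * u := rotation_apply c u
  constructor
  · simp [Complex.orthonormalBasisOneI_repr_apply, hc]
  · simp [Complex.orthonormalBasisOneI_repr_apply, hc]
    ring

/-- `leadE` is homogeneous of degree 0, and `a₀²|X|² - |X'|² = |X|² (cos² α - (1 - a₀²))`, so it is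
the symbol at the saddle `p = cos α`. -/
theorem leadE_eq {γp γm α : ℝ} {X : E3} (hX : 0 < ‖X‖) (hX2 : X 2 < 0)
    (hs : ‖horiz X‖ = ‖X‖ * Real.sin α) (hc : -X 2 = ‖X‖ * Real.cos α)
    (ha : Real.sin α ^ 2 ≤ a0 γp γm ^ 2) :
    (leadE γp γm X : ℂ) = (4 * √γm : ℝ) * symb (a0 γp γm) (Real.cos α) := by
  have hcs := Real.sin_sq_add_cos_sq α
  have hsq : √(a0 γp γm ^ 2 * ‖X‖ ^ 2 - ‖horiz X‖ ^ 2)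
      = ‖X‖ * √(Real.cos α ^ 2 - (1 - a0 γp γm ^ 2)) := by
    rw [hs, show a0 γp γm ^ 2 * ‖X‖ ^ 2 - (‖X‖ * Real.sin α) ^ 2
      = ‖X‖ ^ 2 * (Real.cos α ^ 2 - (1 - a0 γp γm ^ 2)) by
        linear_combination (-‖X‖ ^ 2) * hcs,
      Real.sqrt_mul (by positivity), Real.sqrt_sq hX.le]
  rw [leadE, hsq, abs_of_neg hX2, hc, symb, upperFreq_ofReal (by linarith)]
  generalize √(Real.cos α ^ 2 - (1 - a0 γp γm ^ 2)) = Q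
  rw [show ‖X‖ * (‖X‖ * Q + a0 γp γm ^ 2 * (‖X‖ * Real.cos α))
    = ‖X‖ ^ 2 * (Q + a0 γp γm ^ 2 * Real.cos α) by ring,
    show 4 * √γm * (‖X‖ * Real.cos α) * (‖X‖ * Q)
      = ‖X‖ ^ 2 * (4 * √γm * (Q * Real.cos α)) by ring,
    mul_div_mul_left _ _ (by positivity), mul_div_assoc]
  push_cast
  ring

/-- The error bound of the Laplace asymptotics, as a function of the large parameter. -/
noncomputable def laplaceError (a lam : ℝ) : ℝ :=
  4 * (60 / (a ^ 4 * √(1 - a ^ 2) ^ 2) + 18 / (a ^ 2 * √(1 - a ^ 2))) *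
    (Real.Gamma (5 / 4) * (1 / lam) ^ (1 / 4 : ℝ)
      + Real.Gamma (17 / 4) * (1 / lam) ^ (13 / 4 : ℝ))

/-- For `λ ≥ s₀` the term `λ^(-13/4)` is at most `s₀^(-3) λ^(-1/4)`; this is how `s₀` enters the
constant. -/
theorem laplaceError_le {a s₀ : ℝ} (ha : 0 < a) (ha1 : a < 1) (hs : 0 < s₀) :
    ∃ C : ℝ, 0 < C ∧ ∀ lam, s₀ ≤ lam → laplaceError a lam ≤ C * (1 / lam) ^ (1 / 4 : ℝ) := by
  have hb : 0 < √(1 - a ^ 2) := Real.sqrt_pos.2 (by nlinarith)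
  have h1 : 0 < Real.Gamma (5 / 4) := Real.Gamma_pos_of_pos (by norm_num)
  have h2 : 0 < Real.Gamma (17 / 4) := Real.Gamma_pos_of_pos (by norm_num)
  refine ⟨4 * (60 / (a ^ 4 * √(1 - a ^ 2) ^ 2) + 18 / (a ^ 2 * √(1 - a ^ 2))) *
    (Real.Gamma (5 / 4) + Real.Gamma (17 / 4) * (1 / s₀) ^ 3), by positivity, fun lam hl => ?_⟩
  have hl0 : 0 < lam := hs.trans_le hl
  have hpow : (1 / lam) ^ (13 / 4 : ℝ) ≤ (1 / s₀) ^ 3 * (1 / lam) ^ (1 / 4 : ℝ) := by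
    rw [show (13 / 4 : ℝ) = (3 : ℕ) + 1 / 4 by norm_num,
      Real.rpow_add (show 0 < 1 / lam by positivity),
      Real.rpow_natCast]
    gcongr
  have hK : 0 ≤ 4 * (60 / (a ^ 4 * √(1 - a ^ 2) ^ 2) + 18 / (a ^ 2 * √(1 - a ^ 2))) := by
    positivity
  rw [laplaceError, mul_assoc (4 * _) (_ + _) ((1 / lam) ^ (1 / 4 : ℝ))]
  refine mul_le_mul_of_nonneg_left ?_ hK
  calc _ ≤ Real.Gamma (5 / 4) * (1 / lam) ^ (1 / 4 : ℝ)
        + Real.Gamma (17 / 4) * ((1 / s₀) ^ 3 * (1 / lam) ^ (1 / 4 : ℝ)) := by gcongr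
    _ = _ := by ring

/-- Asymptotics of a superposition of plane waves with an amplitude that is the symbol times an
affine function of the momentum. -/
theorem exists_plane_wave_asymptotics {a κ α : ℝ} (ha : 0 < a) (ha1 : a < 1) (hκ : 0 < κ)
    {X : E3} (hX : 0 < ‖X‖) (hα0 : 0 ≤ α) (hα : α < Real.pi / 2) (hαa : Real.sin α ≤ a)
    (hc : -X 2 = ‖X‖ * Real.cos α) {L : ℂ ≃ₗᵢ[ℝ] E2}
    (hL : ∀ u, inner ℝ (L u) (horiz X) = ‖X‖ * Real.sin α * u.re)
    {q : Fin 4 → ℂ} (hq : ∀ i, ‖q i‖ ≤ 1) :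
    ∃ ε : ℂ, ‖ε‖ ≤ laplaceError a (κ * ‖X‖) ∧
      ∫ u : ℂ, (q 0 + q 1 * u.re + q 2 * u.im + q 3 * height u) *
        (Complex.exp (κ * phase X (L u) (height u)) * ((height u)⁻¹ • symb a (height u)))
      = (2 * Real.pi * Real.exp (-(κ * ‖X‖)) / (κ * ‖X‖) : ℝ) *
        (amp a q (Complex.I * Real.sin α) 0 (Real.cos α) + ε) := by
  set lam := κ * ‖X‖ with hlam
  have hl : 0 < lam := mul_pos hκ hX
  have hb : 0 < √(1 - a ^ 2) := Real.sqrt_pos.2 (by nlinarith)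
  have hs0 : 0 ≤ Real.sin α := Real.sin_nonneg_of_nonneg_of_le_pi hα0 (by linarith [Real.pi_pos])
  have hc0 : 0 < Real.cos α := Real.cos_pos_of_mem_Ioo ⟨by linarith [Real.pi_pos], hα⟩
  have hbα : √(1 - a ^ 2) ≤ Real.cos α := by
    refine Real.sqrt_le_iff.2 ⟨hc0.le, ?_⟩
    nlinarith [Real.sin_sq_add_cos_sq α, pow_le_pow_left₀ hs0 hαa 2]
  have hI : ∀ u : ℂ, (q 0 + q 1 * u.re + q 2 * u.im + q 3 * height u) *
        (Complex.exp (κ * phase X (L u) (height u)) * ((height u)⁻¹ • symb a (height u)))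
      = boostIntegrand a lam α q 0 u := by
    intro u
    have e : (κ : ℂ) * phase X (L u) (height u) = -(lam * ((height u * Real.cos (α - 0) : ℝ)
        - Complex.I * (u.re * Real.sin (α - 0) : ℝ))) := by
      rw [phase, hL, show X 2 = -(‖X‖ * Real.cos α) by linarith, hlam, sub_zero]
      push_cast
      ring
    rw [boostIntegrand, ← e, boostHoriz, boostVert, amp]
    simp only [Real.cos_zero, Real.sin_zero, mul_one, mul_zero, Complex.ofReal_zero, add_zero,
      Complex.real_smul]
    ring
  simp only [hI]
  -- The error is defined as the normalized integral minus its limit, which makes the required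
  -- identity purely algebraic.
  refine ⟨(lam * Complex.exp lam / (2 * Real.pi)) * (∫ u, boostIntegrand a lam α q 0 u)
    - amp a q (Complex.I * Real.sin α) 0 (Real.cos α),
    norm_laplace_sub_le ha ha1 hb hl hα0 hα hαa hbα hq, ?_⟩
  have hexp : Complex.exp lam * Complex.exp (-lam) = 1 := by
    rw [← Complex.exp_add, add_neg_cancel, Complex.exp_zero]
  have hlc : (lam : ℂ) ≠ 0 := by exact_mod_cast hl.ne'
  have hpc : (Real.pi : ℂ) ≠ 0 := by exact_mod_cast Real.pi_ne_zero
  rw [add_sub_cancel]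
  push_cast
  generalize (∫ u, boostIntegrand a lam α q 0 u) = J
  rw [show (2 * Real.pi * Complex.exp (-lam) / lam : ℂ) *
    (lam * Complex.exp lam / (2 * Real.pi) * J) = Complex.exp lam * Complex.exp (-lam) * J by
      field_simp, hexp, one_mul]

theorem rpow_three_halves {γ : ℝ} (hγ : 0 < γ) : γ ^ (3 / 2 : ℝ) = γ * √γ := by
  rw [show (3 / 2 : ℝ) = 1 + 1 / 2 by norm_num, Real.rpow_add hγ, Real.rpow_one,
    Real.sqrt_eq_rpow]

/-- The asymptotics of the refracted part and of its first derivatives. -/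
theorem refractedPart_asymptotics {γp γm δ τ : ℝ} (hγm : 0 < γm) (hγ : γm < γp) (hδ : 0 < δ)
    {x : E3} (hx : x 2 < 0) {z : E2}
    (hz : z ∈ closure (cone γp γm 1 x \ cone γp γm δ x)) (hτ : 0 < τ) :
    (∃ ρ : ℂ, ‖ρ‖ ≤ 4 * √γm * laplaceError (a0 γp γm) (τ * ‖x - lift z‖ / √γm) ∧
      refractedPart γp γm τ x z =
        ((Real.exp (-(τ * ‖x - lift z‖ / √γm)) / (4 * Real.pi * γm * ‖x - lift z‖) : ℝ) : ℂ) *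
          ((leadE γp γm (x - lift z) : ℂ) + ρ)) ∧
    ∀ k : Fin 3, ∃ ρ : ℂ,
      ‖ρ‖ ≤ 4 * √γm * laplaceError (a0 γp γm) (τ * ‖x - lift z‖ / √γm) ∧
      HasPartialAt (fun y => refractedPart γp γm τ y z) k
        (((-τ * Real.exp (-(τ * ‖x - lift z‖ / √γm)) /
          (4 * Real.pi * γm ^ (3 / 2 : ℝ) * ‖x - lift z‖) : ℝ) : ℂ) *
            ((leadG γp γm k (x - lift z) : ℂ) + ρ)) x := by
  obtain ⟨hlow, hup⟩ := bounds_of_mem_closure hz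
  have ha := a0_pos hγm hγ
  have ha1 := a0_lt_one hγm hγ
  have hg : 0 < √γm := Real.sqrt_pos.2 hγm
  have hgs : √γm ^ 2 = γm := Real.sq_sqrt hγm.le
  have hpart := hasPartialAt_refractedPart hγm hτ ha ha1 hx z
  have heq := refractedPart_eq (γp := γp) hγm hτ hx z
  have hX2 : (x - lift z) 2 < 0 := by rwa [sub_lift_apply_two]
  set X := x - lift z with hXdef
  set a := a0 γp γm with hadef
  have hX : 0 < ‖X‖ := by
    refine norm_pos_iff.2 fun h => ?_
    rw [h] at hX2
    simp at hX2
  -- The lower cone bound ensures that `X'` has a direction to which the isometry can be aligned.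
  have hh : 0 < ‖horiz X‖ := lt_of_lt_of_le (by positivity) hlow
  set α := Real.arcsin (‖horiz X‖ / ‖X‖) with hαdef
  have hle : ‖horiz X‖ / ‖X‖ ≤ a := (div_le_iff₀ hX).2 hup
  have hge : 0 ≤ ‖horiz X‖ / ‖X‖ := by positivity
  have hsin : Real.sin α = ‖horiz X‖ / ‖X‖ :=
    Real.sin_arcsin (by linarith) (by linarith)
  have hα0 : 0 ≤ α := Real.arcsin_nonneg.2 hge
  have hα : α < Real.pi / 2 := Real.arcsin_lt_pi_div_two.2 (by linarith)
  have hαa : Real.sin α ≤ a := hsin ▸ hle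
  have hs : ‖horiz X‖ = ‖X‖ * Real.sin α := by
    rw [hsin]
    field_simp
  have hcpos : 0 < Real.cos α := Real.cos_pos_of_mem_Ioo ⟨by linarith [Real.pi_pos], hα⟩
  have hc : -X 2 = ‖X‖ * Real.cos α := by
    refine (sq_eq_sq₀ (by linarith) (by positivity)).1 ?_
    have := norm_E3_sq X
    rw [hs] at this
    linear_combination (-1 : ℝ) * this - ‖X‖ ^ 2 * Real.sin_sq_add_cos_sq α
  have hs2 : Real.sin α ^ 2 ≤ a ^ 2 := pow_le_pow_left₀ (hsin ▸ hge) hαa 2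
  have hlead := leadE_eq hX hX2 hs hc hs2
  obtain ⟨L, o₁, o₂, ho, hw0, hw1, hLu⟩ := exists_adapted_isometry (norm_pos_iff.1 hh)
  have hL : ∀ u, inner ℝ (L u) (horiz X) = ‖X‖ * Real.sin α * u.re := by
    intro u
    rw [← hs, PiLp.inner_apply, Fin.sum_univ_two]
    simp only [RCLike.inner_apply, conj_trivial]
    rw [hw0, hw1, (hLu u).1, (hLu u).2]
    linear_combination (‖horiz X‖ * u.re) * ho
  have hκ : 0 < τ / √γm := by positivity
  have hlam : τ / √γm * ‖X‖ = τ * ‖X‖ / √γm := by ring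
  have hgc : (√γm : ℂ) ≠ 0 := by exact_mod_cast hg.ne'
  have hXc : (‖X‖ : ℂ) ≠ 0 := by exact_mod_cast hX.ne'
  have hτc : (τ : ℂ) ≠ 0 := by exact_mod_cast hτ.ne'
  have hpc : (Real.pi : ℂ) ≠ 0 := by exact_mod_cast Real.pi_ne_zero
  have hgsc : (√γm : ℂ) ^ 2 = γm := by exact_mod_cast hgs
  have hnorm : ∀ ε : ℂ, ‖ε‖ ≤ laplaceError a (τ * ‖X‖ / √γm) →
      ‖((4 * √γm : ℝ) : ℂ) * ε‖ ≤ 4 * √γm * laplaceError a (τ * ‖X‖ / √γm) := by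
    intro ε hε
    rw [norm_mul, Complex.norm_real, Real.norm_of_nonneg (by positivity)]
    gcongr
  constructor
  · obtain ⟨ε, hε, hI⟩ := exists_plane_wave_asymptotics ha ha1 hκ hX hα0 hα hαa hc hL
      (q := ![1, 0, 0, 0]) (by intro i; fin_cases i <;> simp)
    rw [hlam] at hε hI
    refine ⟨(4 * √γm : ℝ) * ε, hnorm ε hε, ?_⟩
    simp only [amp, Matrix.cons_val_zero, Matrix.cons_val_one, Matrix.cons_val, zero_mul, add_zero,
      one_mul, mul_one] at hI
    rw [heq L, hlead, hI]
    push_cast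
    rw [← hgsc]
    field_simp
    ring
  · intro k
    have ho1 : |o₁| ≤ 1 := abs_le_one_iff_mul_self_le_one.2 (by nlinarith [sq_nonneg o₂])
    have ho2 : |o₂| ≤ 1 := abs_le_one_iff_mul_self_le_one.2 (by nlinarith [sq_nonneg o₁])
    -- The factor brought down by `∂_k` is affine in the momentum; at the saddle `(i sin α, 0, cos
    -- α)` the product `i · i = -1` for `k = 0, 1` and `X₃ = -|X| cos α` for `k = 2` give
    -- `-X_k/|X|`.
    obtain ⟨q, hq, hqphase, hqval⟩ : ∃ q : Fin 4 → ℂ, (∀ i, ‖q i‖ ≤ 1) ∧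
        (∀ u : ℂ, phase (EuclideanSpace.single k 1) (L u) (height u)
          = q 0 + q 1 * u.re + q 2 * u.im + q 3 * height u) ∧
        q 0 + q 1 * (Complex.I * Real.sin α) + q 2 * 0 + q 3 * Real.cos α
          = -((X k / ‖X‖ : ℝ) : ℂ) := by
      have hX0 : X 0 = ‖X‖ * Real.sin α * o₁ := by rw [← hs, ← hw0]; simp [horiz]
      have hX1 : X 1 = ‖X‖ * Real.sin α * o₂ := by rw [← hs, ← hw1]; simp [horiz]
      have hX2' : X 2 = -(‖X‖ * Real.cos α) := by linarith
      fin_cases k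
      · refine ⟨![0, Complex.I * o₁, -Complex.I * o₂, 0], ?_, fun u => ?_, ?_⟩
        · intro i; fin_cases i <;> simp [ho1, ho2]
        · simp [phase, horiz, PiLp.inner_apply, Fin.sum_univ_two, hLu]
          ring
        · simp only [Fin.zero_eta, hX0]
          simp
          field_simp
          linear_combination (o₁ * Complex.sin α) * Complex.I_sq
      · refine ⟨![0, Complex.I * o₂, Complex.I * o₁, 0], ?_, fun u => ?_, ?_⟩
        · intro i; fin_cases i <;> simp [ho1, ho2]
        · simp [phase, horiz, PiLp.inner_apply, Fin.sum_univ_two, hLu]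
          ring
        · simp only [Fin.mk_one, hX1]
          simp
          field_simp
          linear_combination (o₂ * Complex.sin α) * Complex.I_sq
      · refine ⟨![0, 0, 0, 1], ?_, fun u => ?_, ?_⟩
        · intro i; fin_cases i <;> simp
        · simp [phase, horiz, PiLp.inner_apply, Fin.sum_univ_two]
        · simp only [Fin.reduceFinMk, hX2']
          simp
          field_simp
    obtain ⟨ε, hε, hI⟩ := exists_plane_wave_asymptotics ha ha1 hκ hX hα0 hα hαa hc hL hq
    rw [hlam] at hε hI
    -- The sign of the remainder is flipped because the prefactor carries `-τ`.
    refine ⟨-((4 * √γm : ℝ) * ε), by rw [norm_neg]; exact hnorm ε hε, ?_⟩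
    have h := hpart L k
    simp only [hqphase, mul_assoc] at h
    rw [integral_const_mul, hI, amp, hqval] at h
    refine (congrArg (fun d => HasPartialAt _ k d x) ?_).mp h
    rw [leadG, rpow_three_halves hγm]
    push_cast
    rw [hlead]
    push_cast
    rw [← hgsc]
    field_simp
    ring

end Main
end TwoLayer

theorem proposition2p2 (γp γm : ℝ) (hγm : 0 < γm) (hγ : γm < γp)
    (δ : ℝ) (hδ0 : 0 < δ) (hδ1 : δ < 1) :
    ∃ (r₀ : TwoLayer.E3 → TwoLayer.E2 → ℝ → ℂ) (r : Fin 3 → TwoLayer.E3 → TwoLayer.E2 → ℝ → ℂ),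
      (∀ x : TwoLayer.E3, x 2 < 0 →
        ∀ z ∈ closure (TwoLayer.cone γp γm 1 x \ TwoLayer.cone γp γm δ x),
        ∀ τ : ℝ, 0 < τ →
          TwoLayer.refractedPart γp γm τ x z =
            ((Real.exp (-(τ * ‖x - TwoLayer.lift z‖ / Real.sqrt γm)) /
                (4 * Real.pi * γm * ‖x - TwoLayer.lift z‖) : ℝ) : ℂ) *
              ((TwoLayer.leadE γp γm (x - TwoLayer.lift z) : ℂ) + r₀ x z τ) ∧
          ∀ k : Fin 3,
            TwoLayer.HasPartialAt (fun y => TwoLayer.refractedPart γp γm τ y z) k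
              (((-τ * Real.exp (-(τ * ‖x - TwoLayer.lift z‖ / Real.sqrt γm)) /
                  (4 * Real.pi * γm ^ (3 / 2 : ℝ) * ‖x - TwoLayer.lift z‖) : ℝ) : ℂ) *
                ((TwoLayer.leadG γp γm k (x - TwoLayer.lift z) : ℂ) + r k x z τ)) x) ∧
      (∀ s₀ : ℝ, 0 < s₀ → ∃ C : ℝ, 0 < C ∧
        ∀ x : TwoLayer.E3, x 2 < 0 →
          ∀ z ∈ closure (TwoLayer.cone γp γm 1 x \ TwoLayer.cone γp γm δ x),
          ∀ τ : ℝ, 0 < τ → s₀ ≤ τ * ‖x - TwoLayer.lift z‖ / Real.sqrt γm →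
            ‖r₀ x z τ‖ ≤ C * (Real.sqrt γm / (τ * ‖x - TwoLayer.lift z‖)) ^ (1 / 4 : ℝ) ∧
            ∀ k : Fin 3,
              ‖r k x z τ‖ ≤ C * (Real.sqrt γm / (τ * ‖x - TwoLayer.lift z‖)) ^ (1 / 4 : ℝ)) := by
  have h := fun (x : TwoLayer.E3) (z : TwoLayer.E2) (τ : ℝ) (hx : x 2 < 0)
    (hz : z ∈ closure (TwoLayer.cone γp γm 1 x \ TwoLayer.cone γp γm δ x)) (hτ : 0 < τ) =>
    TwoLayer.refractedPart_asymptotics hγm hγ hδ0 hx hz hτ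
  have h₀ := fun x z τ hx hz hτ => (h x z τ hx hz hτ).1
  have h₁ := fun k x z τ hx hz hτ => (h x z τ hx hz hτ).2 k
  -- The remainders are fixed before `s₀`, with arbitrary values outside the admissible region;
  -- their bounds are still in terms of `laplaceError`.
  choose! r₀ hr₀ using h₀
  choose! r hr using h₁
  refine ⟨r₀, r, fun x hx z hz τ hτ =>
    ⟨(hr₀ x z τ hx hz hτ).2, fun k => (hr k x z τ hx hz hτ).2⟩, fun s₀ hs₀ => ?_⟩
  obtain ⟨C, hC, hCb⟩ := TwoLayer.laplaceError_le (TwoLayer.a0_pos hγm hγ)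
    (TwoLayer.a0_lt_one hγm hγ) hs₀
  refine ⟨4 * Real.sqrt γm * C, by positivity, fun x hx z hz τ hτ hs => ?_⟩
  have hb := hCb _ hs
  rw [one_div_div] at hb
  have hb' : 4 * Real.sqrt γm * TwoLayer.laplaceError (TwoLayer.a0 γp γm)
      (τ * ‖x - TwoLayer.lift z‖ / Real.sqrt γm) ≤
      4 * Real.sqrt γm * C * (Real.sqrt γm / (τ * ‖x - TwoLayer.lift z‖)) ^ (1 / 4 : ℝ) := by
    rw [mul_assoc (4 * Real.sqrt γm) C]
    gcongr
  exact ⟨(hr₀ x z τ hx hz hτ).1.trans hb', fun k => (hr k x z τ hx hz hτ).1.trans hb'⟩
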